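/- **Notation.** $\mathbb N=\{1,2,\dots\}$, $\mathbb Z_+=\mathbb N\cup\{0\}$, $\langle \mathbf m\rangle=\langle m_1\rangle\times\dots\times\langle m_d\rangle$ with $\langle m\rangle=\{1,\dots,m\}$, $T(\mathbf m)=\prod_k\mathbb Z/m_k\mathbb Z$, $|\mathbf m|_{\rm pr}=m_1\cdots m_d$, and $\mathbf m\to\infty$ means that all coordinates tend to $\infty$. A monomer-dimer cover (dimer cover) of $\langle\mathbf m\rangle$, $T(\mathbf m)$ or a product of the two is encoded as a coloring of its points with the colors $1,\dots,2d+1$ (respectively $1,\dots,2d$): color $k\le d$ at $\mathbf i$ means a dimer joining $\mathbf i$ to $\mathbf i+\mathbf e_k$, color $d+k$ means a dimer joining $\mathbf i$ to $\mathbf i-\mathbf e_k$, and $2d+1$ means a monomer; the only condition is that $\mathbf i$ has color $k$ if and only if $\mathbf i+\mathbf e_k$ has color $d+k$, whenever both points lie in the grid. (So dimers may protrude out of the grid in non-periodic directions, and a torus direction of length $2$ carries two different dimers on the same pair of points.) A tiling is a cover with no protruding dimer. Let $W(\mathbf m)$ be the set of monomer-dimer covers of $\langle\mathbf m\rangle$,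 and $W_{\rm per,\{1\}}(m_1,\mathbf m^-)$ that of $T(m_1)\times\langle\mathbf m^-\rangle$. Put $$h_d=\lim_{\mathbf m\to\infty}\frac{\log\#W(\mathbf m)}{|\mathbf m|_{\rm pr}},\qquad \bar h_{d-1}(m_1)=\lim_{\mathbf m^-\to\infty}\frac{\log\#W_{\rm per,\{1\}}(m_1,\mathbf m^-)}{|\mathbf m^-|_{\rm pr}}\ (m_1\in\mathbb N),\qquad \bar h_{d-1}(0)=\log 2 .$$ For $\mathbf m'\in\mathbb N^{d-1}$ let $A(\mathbf m'),B(\mathbf m'),C(\mathbf m')$ be the matrices indexed by the subsets of $\langle\mathbf m'\rangle$ whose $(S,T)$ entries are $0$ if $S\cap T\ne\emptyset$ and otherwise, with $U=\langle\mathbf m'\rangle\setminus(S\cup T)$: for $A$, the number of monomer-dimer tilings of $U$ as a subset of $\langle\mathbf m'\rangle$; for $B$, the number of monomer-dimer tilings of $U$ as a subset of $T(\mathbf m')$; for $C$, the number of monomer-dimer covers of $U$ in which dimers may protrude out of $\langle\mathbf m'\rangle$ but do not meet $S\cup T$. Let $\alpha(\mathbf m'),\beta(\mathbf m'),\gamma(\mathbf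 m')$ be their spectral radii. Let $\tilde h_d$, $\check h_{d-1}$ (with $\check h_{d-1}(0)=\log 2$), $\tilde\alpha,\tilde\beta,\tilde\gamma$ be defined in the same way with dimer covers and tilings (no monomers). **Theorem 6.5.** Let $d\ge 2$. The limits defining $h_d$, $\tilde h_d$, and $\bar h_{d-1}(m_1)$, $\check h_{d-1}(m_1)$ for $m_1\in\mathbb N$, exist as finite real numbers. For all $p,r\in\mathbb N$ and $q\in\mathbb Z_+$, $$\frac{\bar h_{d-1}(2r)}{2r}\ \ge\ h_d\ \ge\ \frac{\bar h_{d-1}(p+2q)-\bar h_{d-1}(2q)}{p},\qquad \frac{\check h_{d-1}(2r)}{2r}\ \ge\ \tilde h_d\ \ge\ \frac{\check h_{d-1}(p+2q)-\check h_{d-1}(2q)}{p}.$$ If $\mathbf m'=(m_1,\dots,m_{d-1})\in\mathbb N^{d-1}$ and all $m_i$ are even, then $$h_d\le\frac{\log\beta(\mathbf m')}{|\mathbf m'|_{\rm pr}},\qquad \tilde h_d\le\frac{\log\tilde\beta(\mathbf m')}{|\mathbf m'|_{\rm pr}}.$$ Moreover $$h_d=\lim_{\mathbf m'\to\infty}\frac{\log\alpha(\mathbf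 m')}{|\mathbf m'|_{\rm pr}}=\lim_{\mathbf m'\to\infty}\frac{\log\beta(\mathbf m')}{|\mathbf m'|_{\rm pr}}=\lim_{\mathbf m'\to\infty}\frac{\log\gamma(\mathbf m')}{|\mathbf m'|_{\rm pr}},\qquad \tilde h_d=\lim_{\mathbf m'\to\infty}\frac{\log\tilde\alpha(\mathbf m')}{|\mathbf m'|_{\rm pr}}=\lim_{\mathbf m'\to\infty}\frac{\log\tilde\beta(\mathbf m')}{|\mathbf m'|_{\rm pr}}=\lim_{\mathbf m'\to\infty}\frac{\log\tilde\gamma(\mathbf m')}{|\mathbf m'|_{\rm pr}}.$$ -/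

import Mathlib

open Filter Topology

namespace MonomerDimer

/-- The two kinds of covers: by monomers and dimers, or by dimers only. -/
inductive Kind : Type where
  | monomerDimer
  | dimer

/-- The `2 n + 1` colors that encode covers of an `n`-dimensional grid. A point `i` gets the color
`fwd k` if it is covered by the dimer `{i, i + e_k}`, the color `bwd k` if it is covered by the
dimer `{i - e_k, i}`, and the color `mono` if it is covered by a monomer. -/
inductive Color (n : ℕ) : Type where
  | fwd (k : Fin n)
  | bwd (k : Fin n)
  | mono
  deriving DecidableEq, Fintype

/-- The color `c` occurs in covers of the given kind: all colors are allowed in monomer-dimer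
covers, and all colors but `mono` in dimer covers. -/
def Allowed {n : ℕ} (κ : Kind) (c : Color n) : Prop :=
  κ = Kind.dimer → c ≠ Color.mono

/-- The nearest neighbor digraph `Γ_k`: the colors `c`, `c'` may be given to `i` and `i + e_k`,
respectively, if and only if `c = fwd k ↔ c' = bwd k`. -/
def Gam {n : ℕ} (k : Fin n) (c c' : Color n) : Prop :=
  c = Color.fwd k ↔ c' = Color.bwd k

/-- The points of the box with side lengths `m 0, …, m (n - 1)` (coordinates start at `0`). They
are also the points of the torus `T(m)`, and of the mixed grids that are periodic in some
directions only. -/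
abbrev Box {n : ℕ} (m : Fin n → ℕ) : Type := (k : Fin n) → Fin (m k)

/-- `j = i + e_k` in the grid `T(m_K) × ⟨m_{Kᶜ}⟩`, which is periodic with period `m k` in the
directions `k ∈ K` and an ordinary box in the other directions. -/
def Step {n : ℕ} (K : Set (Fin n)) (m : Fin n → ℕ) (k : Fin n) (i j : Box m) : Prop :=
  (∀ l, l ≠ k → i l = j l) ∧
    ((j k : ℕ) = (i k : ℕ) + 1 ∨ (k ∈ K ∧ (i k : ℕ) + 1 = m k ∧ (j k : ℕ) = 0))

/-- The set `W_{per,K}(m)` of covers of `T(m_K) × ⟨m_{Kᶜ}⟩`, as colorings: neighbors in the grid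
are colored compatibly. Dimers may protrude in the directions outside `K`. -/
def perCovers {n : ℕ} (κ : Kind) (K : Set (Fin n)) (m : Fin n → ℕ) : Set (Box m → Color n) :=
  {φ | (∀ i, Allowed κ (φ i)) ∧ ∀ k i j, Step K m k i j → Gam k (φ i) (φ j)}

/-- The volume `|m|_pr = m_1 ⋯ m_n`. -/
noncomputable def vol {n : ℕ} (m : Fin n → ℕ) : ℝ := ∏ k, (m k : ℝ)

/-- `log #W(m) / |m|_pr`. -/
noncomputable def boxRate (κ : Kind) (d : ℕ) (m : Fin d → ℕ) : ℝ :=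
  Real.log (perCovers κ ∅ m).ncard / vol m

/-- The `d`-dimensional monomer-dimer entropy `h_d`, respectively dimer entropy `h̃_d`: the limit of
`log #W(m) / |m|_pr` as all coordinates of `m` tend to infinity. -/
noncomputable def entropy (κ : Kind) (d : ℕ) : ℝ :=
  limUnder atTop (boxRate κ d)

/-- `log #W_{per,{1}}(m₁, m⁻) / |m⁻|_pr`, where `m⁻` has `n` coordinates. -/
noncomputable def cylRate (κ : Kind) (n m₁ : ℕ) (m : Fin n → ℕ) : ℝ :=
  Real.log (perCovers κ {0} (Fin.cons m₁ m : Fin (n + 1) → ℕ)).ncard / vol m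

/-- The entropy `h̄_n(m₁)` of the covers of the `(n+1)`-dimensional grid that are periodic with
period `m₁` in the first direction: the limit of `log #W_{per,{1}}(m₁, m⁻) / |m⁻|_pr` as all `n`
coordinates of `m⁻` tend to infinity. By convention it is `log 2` for `m₁ = 0`. -/
noncomputable def cylEntropy (κ : Kind) (n m₁ : ℕ) : ℝ :=
  if m₁ = 0 then Real.log 2 else limUnder atTop (cylRate κ n m₁)

/-- The covers of a subset `U` of the grid `T(m_K) × ⟨m_{Kᶜ}⟩` such that monomers lie in `U` and
every dimer meets `U` and meets no grid point outside `U`. Dimers may protrude out of the grid. -/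
def coversOf {n : ℕ} (κ : Kind) (K : Set (Fin n)) (m : Fin n → ℕ) (U : Finset (Box m)) :
    Set (U → Color n) :=
  {φ | (∀ i, Allowed κ (φ i)) ∧
    (∀ k (i j : U), Step K m k i j → Gam k (φ i) (φ j)) ∧
    (∀ k (i : U) (j : Box m), j ∉ U → Step K m k i j → φ i ≠ Color.fwd k) ∧
    (∀ k (i : Box m) (j : U), i ∉ U → Step K m k i j → φ j ≠ Color.bwd k)}

/-- The tilings of a subset `U` of the grid `T(m_K) × ⟨m_{Kᶜ}⟩`: the covers in which, moreover, no
dimer protrudes out of the grid. -/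
def tilingsOf {n : ℕ} (κ : Kind) (K : Set (Fin n)) (m : Fin n → ℕ) (U : Finset (Box m)) :
    Set (U → Color n) :=
  {φ | φ ∈ coversOf κ K m U ∧
    (∀ k (i : U), φ i = Color.fwd k → ∃ j : Box m, Step K m k i j) ∧
    (∀ k (j : U), φ j = Color.bwd k → ∃ i : Box m, Step K m k i j)}

/-- The matrix `A(m')`, indexed by the subsets of the box: for disjoint `S`, `T` its entry is the
number of tilings of `U = (S ∪ T)ᶜ` as a subset of the box. -/
noncomputable def matA {n : ℕ} (κ : Kind) (m : Fin n → ℕ) :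
    Matrix (Finset (Box m)) (Finset (Box m)) ℂ :=
  fun S T => if Disjoint S T then ((tilingsOf κ ∅ m (S ∪ T)ᶜ).ncard : ℂ) else 0

/-- The transfer matrix `B(m')`: for disjoint `S`, `T` its entry is the number of tilings of
`U = (S ∪ T)ᶜ` as a subset of the torus `T(m')`. -/
noncomputable def matB {n : ℕ} (κ : Kind) (m : Fin n → ℕ) :
    Matrix (Finset (Box m)) (Finset (Box m)) ℂ :=
  fun S T => if Disjoint S T then ((tilingsOf κ Set.univ m (S ∪ T)ᶜ).ncard : ℂ) else 0

/-- The matrix `C(m')`: for disjoint `S`, `T` its entry is the number of covers of `U = (S ∪ T)ᶜ`,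
in which dimers may protrude out of the box but may not meet `S ∪ T`. -/
noncomputable def matC {n : ℕ} (κ : Kind) (m : Fin n → ℕ) :
    Matrix (Finset (Box m)) (Finset (Box m)) ℂ :=
  fun S T => if Disjoint S T then ((coversOf κ ∅ m (S ∪ T)ᶜ).ncard : ℂ) else 0

/-- The spectral radius of `A(m')`. -/
noncomputable def alphaRad {n : ℕ} (κ : Kind) (m : Fin n → ℕ) : ℝ :=
  (spectralRadius ℂ (matA κ m)).toReal

/-- The spectral radius of `B(m')`. -/
noncomputable def betaRad {n : ℕ} (κ : Kind) (m : Fin n → ℕ) : ℝ :=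
  (spectralRadius ℂ (matB κ m)).toReal

/-- The spectral radius of `C(m')`. -/
noncomputable def gammaRad {n : ℕ} (κ : Kind) (m : Fin n → ℕ) : ℝ :=
  (spectralRadius ℂ (matC κ m)).toReal

end MonomerDimer

/-! Cut a grid into layers orthogonal to a direction. A cover becomes a sequence of layer colorings
in which the points matched forward from one layer are exactly the points matched backward from the
next. It is thus a walk on the subsets of a layer, with steps counted by a symmetric matrix M,
`transferMat`, which is the same for every slicing direction. If the direction is open, with L
layers, the covers are all walks, and their number is the entry sum of M^L. If it is periodic, they
are the closed walks, and their number is the trace of M^L.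

Let ρ be the spectral radius of M. Real eigenvalues and ρ = ‖M‖ give three estimates. The entry sum
of M^L is at most a constant times ρ^L. For even L, ρ^L ≤ tr M^L. Finally tr M^(p+2q) ≤ ρ^p tr
M^(2q), which yields the lower bound for the entropy (`cylEntropy_sub_div_le`).

Cutting a box never decreases the product of the counts, so a multivariate Fekete lemma gives the
limits, and h is an infimum: every box has at least exp(h vol) covers. This bound survives closing
up directions of even length one at a time (`exp_entropy_le_ncard_perCovers`): while the direction
is open, arbitrarily long boxes force ρ ≥ exp(h vol) for the layer, and then the trace of an even
power is at least that power of ρ. The upper bounds by cylinders and by β follow.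

For γ, the same inequality ρ ≥ exp(h vol) is complemented by ρ^(2r) being at most the number of
covers of a box of height 2r. Entrywise comparison gives α ≤ β ≤ γ. Conversely, adding one layer on
each side makes room for the protruding dimers, so γ(m) ≤ 2^c α(m + 2), where c is the number of
added points and is negligible against the volume (`gammaRad_le_two_pow_mul_alphaRad`). Both kinds
of covers are handled together because the dimer colors are always allowed. -/

namespace MonomerDimer

/-! ### Spectral radii of symmetric matrices with natural entries -/

section Spectral

set_option linter.unusedSectionVars false

open scoped Matrix.Norms.L2Operator

variable {V W : Type*} [Fintype V] [DecidableEq V] [Fintype W] [DecidableEq W]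

/-- The spectral radius of a matrix with natural number entries. -/
noncomputable def specRad (M : Matrix V V ℕ) : ℝ :=
  (spectralRadius ℂ (M.map (Nat.cast : ℕ → ℂ))).toReal

theorem isHermitian_map_natCast {M : Matrix V V ℕ} (hM : M.IsSymm) :
    (M.map (Nat.cast : ℕ → ℂ)).IsHermitian := by
  ext i j
  simp [Matrix.conjTranspose_apply, hM.apply i j]

theorem map_natCast_pow (M : Matrix V V ℕ) (k : ℕ) :
    (M ^ k).map (Nat.cast : ℕ → ℂ) = (M.map (Nat.cast : ℕ → ℂ)) ^ k :=
  map_pow (Nat.castRingHom ℂ).mapMatrix M k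

/-- For a self-adjoint element of a C*-algebra, spectral radius and norm agree; the norm here is the
l2 operator norm. Triangle inequality, submultiplicativity and the C*-identity thus become available
for `specRad`. -/
theorem specRad_eq_norm {M : Matrix V V ℕ} (hM : M.IsSymm) :
    specRad M = ‖M.map (Nat.cast : ℕ → ℂ)‖ := by
  have h : IsSelfAdjoint (M.map (Nat.cast : ℕ → ℂ)) := isHermitian_map_natCast hM
  have h2 := h.spectralRadius_eq_nnnorm
  unfold specRad
  rw [h2]
  simp

theorem specRad_nonneg (M : Matrix V V ℕ) : 0 ≤ specRad M := ENNReal.toReal_nonneg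

theorem trace_pow_eq_sum_eigenvalues {A : Matrix V V ℂ} (hA : A.IsHermitian) (k : ℕ) :
    (A ^ k).trace = ((∑ i, hA.eigenvalues i ^ k : ℝ) : ℂ) := by
  conv_lhs => rw [hA.spectral_theorem, ← map_pow, Unitary.conjStarAlgAut_apply,
    Matrix.trace_mul_comm, ← mul_assoc, Unitary.coe_star_mul_self, one_mul,
    Matrix.diagonal_pow, Matrix.trace_diagonal]
  simp

theorem trace_pow_cast_eq {M : Matrix V V ℕ} (hM : M.IsSymm) (k : ℕ) :
    (((M ^ k).trace : ℕ) : ℝ) = ∑ i, (isHermitian_map_natCast hM).eigenvalues i ^ k := by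
  have h := trace_pow_eq_sum_eigenvalues (isHermitian_map_natCast hM) k
  rw [← map_natCast_pow] at h
  have h2 : ((M ^ k).map (Nat.cast : ℕ → ℂ)).trace = ((M ^ k).trace : ℂ) := by
    simp [Matrix.trace]
  rw [h2] at h
  exact_mod_cast h

theorem abs_eigenvalues_le_specRad {M : Matrix V V ℕ} (hM : M.IsSymm) (i : V) :
    |(isHermitian_map_natCast hM).eigenvalues i| ≤ specRad M := by
  have h : (((isHermitian_map_natCast hM).eigenvalues i : ℝ) : ℂ) ∈
      spectrum ℂ (M.map (Nat.cast : ℕ → ℂ)) := by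
    rw [(isHermitian_map_natCast hM).spectrum_eq_image_range]
    exact ⟨_, ⟨i, rfl⟩, rfl⟩
  have : Nonempty V := ⟨i⟩
  have := spectrum.norm_le_norm_of_mem h
  rw [specRad_eq_norm hM]
  simpa using this

theorem exists_abs_eigenvalues_eq_specRad [Nonempty V] {M : Matrix V V ℕ} (hM : M.IsSymm) :
    ∃ i, specRad M = |(isHermitian_map_natCast hM).eigenvalues i| := by
  obtain ⟨z, hz, hzr⟩ := spectrum.exists_nnnorm_eq_spectralRadius (M.map (Nat.cast : ℕ → ℂ))
  rw [(isHermitian_map_natCast hM).spectrum_eq_image_range] at hz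
  obtain ⟨_, ⟨i, rfl⟩, rfl⟩ := hz
  refine ⟨i, ?_⟩
  rw [specRad, ← hzr]
  simp

/-- Even powers of the real eigenvalues are nonnegative, so the trace dominates the term of largest
modulus. -/
theorem specRad_pow_le_trace [Nonempty V] {M : Matrix V V ℕ} (hM : M.IsSymm) {k : ℕ}
    (hk : Even k) : specRad M ^ k ≤ ((M ^ k).trace : ℕ) := by
  obtain ⟨i, hi⟩ := exists_abs_eigenvalues_eq_specRad hM
  rw [trace_pow_cast_eq hM, hi, hk.pow_abs]
  exact Finset.single_le_sum (f := fun i => (isHermitian_map_natCast hM).eigenvalues i ^ k)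
    (fun j _ => hk.pow_nonneg _) (Finset.mem_univ i)

/-- Eigenvalue by eigenvalue, λ^(p+2q) ≤ |λ|^p λ^(2q). The factor 2 keeps the weights λ^(2q)
nonnegative, so that |λ|^p may be replaced by its maximum. -/
theorem trace_pow_add_le {M : Matrix V V ℕ} (hM : M.IsSymm) (p q : ℕ) :
    (((M ^ (p + 2 * q)).trace : ℕ) : ℝ) ≤ specRad M ^ p * ((M ^ (2 * q)).trace : ℕ) := by
  rw [trace_pow_cast_eq hM, trace_pow_cast_eq hM, Finset.mul_sum]
  refine Finset.sum_le_sum fun i _ => ?_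
  rw [pow_add]
  have h2 : 0 ≤ (isHermitian_map_natCast hM).eigenvalues i ^ (2 * q) :=
    (even_two_mul q).pow_nonneg _
  refine mul_le_mul_of_nonneg_right ?_ h2
  calc _ ≤ |(isHermitian_map_natCast hM).eigenvalues i ^ p| := le_abs_self _
    _ = |(isHermitian_map_natCast hM).eigenvalues i| ^ p := abs_pow _ _
    _ ≤ _ := pow_le_pow_left₀ (abs_nonneg _) (abs_eigenvalues_le_specRad hM i) _

theorem norm_entry_le_l2_opNorm (A : Matrix V V ℂ) (i j : V) : ‖A i j‖ ≤ ‖A‖ := by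
  have h := Matrix.l2_opNorm_mulVec A (EuclideanSpace.single j (1 : ℂ))
  have h2 := PiLp.norm_apply_le (WithLp.toLp 2 (A.mulVec (Pi.single j (1 : ℂ)))) i
  simp only [Matrix.mulVec_single_one] at h2
  refine h2.trans ?_
  simpa using h

theorem pow_apply_le_specRad_pow {M : Matrix V V ℕ} (hM : M.IsSymm) (k : ℕ) (i j : V) :
    (((M ^ k) i j : ℕ) : ℝ) ≤ specRad M ^ k := by
  have : Nonempty V := ⟨i⟩
  have h := norm_entry_le_l2_opNorm ((M ^ k).map (Nat.cast : ℕ → ℂ)) i j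
  rw [specRad_eq_norm hM]
  have h2 : ‖(M ^ k).map (Nat.cast : ℕ → ℂ)‖ ≤ ‖M.map (Nat.cast : ℕ → ℂ)‖ ^ k := by
    rw [map_natCast_pow]; exact norm_pow_le _ _
  refine le_trans ?_ h2
  simpa using h

/-- The sum of all entries of a matrix. -/
def entrySum (M : Matrix V V ℕ) : ℕ := ∑ i, ∑ j, M i j

theorem entrySum_pow_le {M : Matrix V V ℕ} (hM : M.IsSymm) (k : ℕ) :
    ((entrySum (M ^ k) : ℕ) : ℝ) ≤ (Fintype.card V : ℝ) ^ 2 * specRad M ^ k := by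
  unfold entrySum
  push_cast
  calc _ ≤ ∑ i : V, ∑ j : V, specRad M ^ k :=
        Finset.sum_le_sum fun i _ => Finset.sum_le_sum fun j _ => pow_apply_le_specRad_pow hM k i j
    _ = _ := by simp [sq, mul_assoc]

theorem trace_le_entrySum (M : Matrix V V ℕ) : M.trace ≤ entrySum M :=
  Finset.sum_le_sum fun i _ =>
    Finset.single_le_sum (f := fun j => M i j) (fun _ _ => Nat.zero_le _) (Finset.mem_univ i)

/-- The right side drops the condition that the two partial walks meet at a common vertex. This is
the source of the submultiplicativity of the numbers of covers. -/
theorem entrySum_pow_add_le (M : Matrix V V ℕ) (k l : ℕ) :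
    entrySum (M ^ (k + l)) ≤ entrySum (M ^ k) * entrySum (M ^ l) := by
  unfold entrySum
  rw [pow_add]
  calc ∑ i, ∑ j, (M ^ k * M ^ l) i j
      = ∑ i, ∑ j, ∑ r, (M ^ k) i r * (M ^ l) r j := by simp [Matrix.mul_apply]
    _ = ∑ i, ∑ r, (M ^ k) i r * ∑ j, (M ^ l) r j := by
        refine Finset.sum_congr rfl fun i _ => ?_
        rw [Finset.sum_comm]
        simp [Finset.mul_sum]
    _ ≤ ∑ i, ∑ r, (M ^ k) i r * ∑ s, ∑ j, (M ^ l) s j := by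
        refine Finset.sum_le_sum fun i _ => Finset.sum_le_sum fun r _ => Nat.mul_le_mul_left _ ?_
        exact Finset.single_le_sum (f := fun r => ∑ j, (M ^ l) r j)
          (fun _ _ => Nat.zero_le _) (Finset.mem_univ r)
    _ = _ := by simp [Finset.sum_mul]

theorem specRad_pow_le_entrySum [Nonempty V] {M : Matrix V V ℕ} (hM : M.IsSymm) {k : ℕ}
    (hk : Even k) : specRad M ^ k ≤ (entrySum (M ^ k) : ℕ) :=
  (specRad_pow_le_trace hM hk).trans (by exact_mod_cast trace_le_entrySum _)

theorem le_of_forall_pow_le_mul_pow {a b c : ℝ} (hb : 0 ≤ b)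
    (h : ∀ k : ℕ, 0 < k → a ^ k ≤ c * b ^ k) : a ≤ b := by
  by_contra! hab
  rcases hb.eq_or_lt with rfl | hb
  · have := h 1 one_pos
    simp at this
    linarith
  · have h1 : 1 < a / b := by rwa [one_lt_div hb]
    -- The 1 in the maximum rules out k = 0, where the hypothesis says nothing.
    obtain ⟨k, hk⟩ := pow_unbounded_of_one_lt (max c 1) h1
    have hk0 : 0 < k := by
      rcases Nat.eq_zero_or_pos k with rfl | h'
      · simp at hk
      · exact h'
    have h2 := h k hk0
    rw [div_pow, lt_div_iff₀ (by positivity)] at hk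
    have h3 : c * b ^ k ≤ max c 1 * b ^ k := by gcongr; exact le_max_left _ _
    linarith

theorem pow_apply_le_pow_apply {M : Matrix V V ℕ} {M' : Matrix W W ℕ} {e : V → W}
    (he : Function.Injective e) (h : ∀ i j, M i j ≤ M' (e i) (e j)) (k : ℕ) (i j : V) :
    (M ^ k) i j ≤ (M' ^ k) (e i) (e j) := by
  induction k generalizing i j with
  | zero => simp [Matrix.one_apply, he.eq_iff]
  | succ k ih =>
    rw [pow_succ, pow_succ, Matrix.mul_apply, Matrix.mul_apply]
    calc _ ≤ ∑ r, (M' ^ k) (e i) (e r) * M' (e r) (e j) :=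
          Finset.sum_le_sum fun r _ => Nat.mul_le_mul (ih i r) (h r j)
      _ = ∑ s ∈ Finset.univ.map ⟨e, he⟩, (M' ^ k) (e i) s * M' s (e j) := by simp
      _ ≤ _ := Finset.sum_le_sum_of_subset (Finset.subset_univ _)

theorem entrySum_pow_le_of_embedding {M : Matrix V V ℕ} {M' : Matrix W W ℕ} {e : V → W}
    (he : Function.Injective e) (h : ∀ i j, M i j ≤ M' (e i) (e j)) (k : ℕ) :
    entrySum (M ^ k) ≤ entrySum (M' ^ k) := by
  unfold entrySum
  calc _ ≤ ∑ i, ∑ j, (M' ^ k) (e i) (e j) :=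
        Finset.sum_le_sum fun i _ => Finset.sum_le_sum fun j _ => pow_apply_le_pow_apply he h k i j
    _ = ∑ s ∈ Finset.univ.map ⟨e, he⟩, ∑ t ∈ Finset.univ.map ⟨e, he⟩, (M' ^ k) s t := by simp
    _ ≤ ∑ s ∈ Finset.univ.map ⟨e, he⟩, ∑ t, (M' ^ k) s t :=
        Finset.sum_le_sum fun s _ => Finset.sum_le_sum_of_subset (Finset.subset_univ _)
    _ ≤ _ := Finset.sum_le_sum_of_subset (Finset.subset_univ _)

/-- Monotonicity without Perron–Frobenius theory: ρ(M)^(2k) is at most the entry sum of M^(2k),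
hence at most that of M'^(2k), hence at most |W|^2 ρ(M')^(2k). Letting k grow removes the constant.
-/
theorem specRad_le_of_embedding [Nonempty V] {M : Matrix V V ℕ} {M' : Matrix W W ℕ}
    (hM : M.IsSymm) (hM' : M'.IsSymm) {e : V → W}
    (he : Function.Injective e) (h : ∀ i j, M i j ≤ M' (e i) (e j)) :
    specRad M ≤ specRad M' := by
  have key : specRad M ^ 2 ≤ specRad M' ^ 2 := by
    refine le_of_forall_pow_le_mul_pow (c := (Fintype.card W : ℝ) ^ 2)
      (by positivity) fun k _ => ?_
    rw [← pow_mul, ← pow_mul]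
    refine (specRad_pow_le_entrySum hM (even_two_mul k)).trans
      (le_trans ?_ (entrySum_pow_le hM' _))
    exact_mod_cast entrySum_pow_le_of_embedding he h _
  exact (pow_le_pow_iff_left₀ (specRad_nonneg _) (specRad_nonneg _) two_ne_zero).1 key

theorem specRad_sum_le {ι : Type*} (s : Finset ι) (M : ι → Matrix V V ℕ)
    (hM : ∀ i ∈ s, (M i).IsSymm) : specRad (∑ i ∈ s, M i) ≤ ∑ i ∈ s, specRad (M i) := by
  have hs : (∑ i ∈ s, M i).IsSymm := by
    unfold Matrix.IsSymm
    rw [Matrix.transpose_sum]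
    exact Finset.sum_congr rfl hM
  rw [specRad_eq_norm hs]
  have h : (∑ i ∈ s, M i).map (Nat.cast : ℕ → ℂ) = ∑ i ∈ s, (M i).map (Nat.cast : ℕ → ℂ) :=
    map_sum (Nat.castRingHom ℂ).mapMatrix M s
  rw [h]
  refine (norm_sum_le _ _).trans (Finset.sum_le_sum fun i hi => ?_)
  rw [specRad_eq_norm (hM i hi)]

theorem specRad_sq {M : Matrix V V ℕ} (hM : M.IsSymm) : specRad (M ^ 2) = specRad M ^ 2 := by
  rw [specRad_eq_norm (hM.pow 2), specRad_eq_norm hM, map_natCast_pow]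
  have h : IsSelfAdjoint (M.map (Nat.cast : ℕ → ℂ)) := isHermitian_map_natCast hM
  rw [sq, sq]
  nth_rewrite 1 [← h.star_eq]
  exact CStarRing.norm_star_mul_self

end Spectral

/-! ### Powers of an adjacency matrix count walks -/

section Walks

variable {Λ V : Type*} [Fintype Λ] [Fintype V] [DecidableEq V]

open Classical in
/-- The number of arrows from `S` to `T` in the digraph with vertices `V` whose arrows are the
elements of `Λ` that satisfy `P`, with source `s` and target `t`. -/
noncomputable def arrowMat (P : Λ → Prop) (s t : Λ → V) : Matrix V V ℕ :=
  fun S T => (Finset.univ.filter fun a => P a ∧ s a = S ∧ t a = T).card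

variable (P : Λ → Prop) (s t : Λ → V)

open Classical in
theorem arrowMat_pow_succ_apply (l : ℕ) (S T : V) :
    (arrowMat P s t ^ (l + 1)) S T = (Finset.univ.filter fun f : Fin (l + 1) → Λ =>
      (∀ x, P (f x)) ∧ (∀ x : Fin l, t (f x.castSucc) = s (f x.succ)) ∧
        s (f 0) = S ∧ t (f (Fin.last l)) = T).card := by
  induction l generalizing S T with
  | zero =>
    change (arrowMat P s t ^ 1) S T = _
    rw [pow_one, arrowMat]
    refine Finset.card_equiv (Equiv.funUnique (Fin 1) Λ).symm fun a => ?_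
    simp
  | succ l ih =>
    rw [pow_succ', Matrix.mul_apply]
    have h : (Finset.univ.filter fun f : Fin (l + 1 + 1) → Λ =>
        (∀ x, P (f x)) ∧ (∀ x : Fin (l + 1), t (f x.castSucc) = s (f x.succ)) ∧
        s (f 0) = S ∧ t (f (Fin.last (l + 1))) = T).card =
        (Finset.univ.filter fun g : Λ × (Fin (l + 1) → Λ) =>
          (P g.1 ∧ s g.1 = S) ∧ t g.1 = s (g.2 0) ∧ (∀ x, P (g.2 x)) ∧
          (∀ x : Fin l, t (g.2 x.castSucc) = s (g.2 x.succ)) ∧ t (g.2 (Fin.last l)) = T).card := by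
      symm
      refine Finset.card_equiv (Fin.consEquiv fun _ => Λ) fun g => ?_
      simp only [Finset.mem_filter, Finset.mem_univ, true_and, Fin.consEquiv, Equiv.coe_fn_mk,
        Fin.forall_fin_succ (P := fun x => P _), Fin.cons_zero, Fin.cons_succ,
        Fin.forall_fin_succ (P := fun x => t _ = _), Fin.castSucc_zero, ← Fin.succ_castSucc,
        ← Fin.succ_last]
      tauto
    -- After splitting off the first arrow, sort the walks by its target, which is the summation
    -- index of the matrix product.
    rw [h, Finset.card_eq_sum_card_fiberwise (f := fun g => t g.1) (t := Finset.univ)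
      (fun _ _ => Finset.mem_coe.2 (Finset.mem_univ _))]
    refine Finset.sum_congr rfl fun R _ => ?_
    rw [ih, arrowMat, ← Finset.card_product]
    congr 1
    ext ⟨a, f⟩
    simp only [Finset.mem_product, Finset.mem_filter, Finset.mem_univ, true_and]
    constructor
    · rintro ⟨⟨h1, h2, h3⟩, h4, h5, h6, h7⟩
      exact ⟨⟨⟨h1, h2⟩, h3.trans h6.symm, h4, h5, h7⟩, h3⟩
    · rintro ⟨⟨⟨h1, h2⟩, h3, h4, h5, h7⟩, h8⟩
      exact ⟨⟨h1, h2, h8⟩, h4, h5, h3.symm.trans h8, h7⟩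

theorem forall_val_eq_add_one_iff {l : ℕ} (Q : Fin (l + 1) → Fin (l + 1) → Prop) :
    (∀ x y : Fin (l + 1), (y : ℕ) = x + 1 → Q x y) ↔ ∀ x : Fin l, Q x.castSucc x.succ := by
  constructor
  · intro h x
    exact h _ _ (by simp)
  · intro h x y hxy
    have hx : (x : ℕ) < l := by omega
    have hy : y = Fin.succ ⟨x, hx⟩ := Fin.ext hxy
    rw [hy]
    exact h ⟨x, hx⟩

open Classical in
theorem entrySum_arrowMat_pow {L : ℕ} (hL : 0 < L) :
    entrySum (arrowMat P s t ^ L) = (Finset.univ.filter fun f : Fin L → Λ =>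
      (∀ x, P (f x)) ∧ ∀ x y : Fin L, (y : ℕ) = x + 1 → t (f x) = s (f y)).card := by
  obtain ⟨l, rfl⟩ := Nat.exists_eq_succ_of_ne_zero hL.ne'
  simp only [Nat.succ_eq_add_one, forall_val_eq_add_one_iff]
  rw [Finset.card_eq_sum_card_fiberwise (f := fun f => s (f 0)) (t := Finset.univ)
      (fun _ _ => Finset.mem_coe.2 (Finset.mem_univ _)), entrySum]
  refine Finset.sum_congr rfl fun S _ => ?_
  rw [Finset.card_eq_sum_card_fiberwise (f := fun f => t (f (Fin.last l))) (t := Finset.univ)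
      (fun _ _ => Finset.mem_coe.2 (Finset.mem_univ _))]
  refine Finset.sum_congr rfl fun T _ => ?_
  rw [arrowMat_pow_succ_apply]
  congr 1
  ext f
  simp only [Finset.mem_filter, Finset.mem_univ, true_and]
  tauto

open Classical in
-- The adjacency condition is cyclic in the same form as in `Step`, so L = 1 correctly asks the
-- single arrow to be a loop.
theorem trace_arrowMat_pow {L : ℕ} (hL : 0 < L) :
    (arrowMat P s t ^ L).trace = (Finset.univ.filter fun f : Fin L → Λ =>
      (∀ x, P (f x)) ∧ ∀ x y : Fin L,
        ((y : ℕ) = x + 1 ∨ (x : ℕ) + 1 = L ∧ (y : ℕ) = 0) → t (f x) = s (f y)).card := by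
  obtain ⟨l, rfl⟩ := Nat.exists_eq_succ_of_ne_zero hL.ne'
  have h : ∀ f : Fin (l + 1) → Λ, (∀ x y : Fin (l + 1),
      ((y : ℕ) = x + 1 ∨ (x : ℕ) + 1 = l + 1 ∧ (y : ℕ) = 0) → t (f x) = s (f y)) ↔
      (∀ x : Fin l, t (f x.castSucc) = s (f x.succ)) ∧ t (f (Fin.last l)) = s (f 0) := by
    intro f
    rw [← forall_val_eq_add_one_iff (fun x y => t (f x) = s (f y))]
    constructor
    · exact fun h => ⟨fun x y hxy => h x y (Or.inl hxy), h _ _ (Or.inr (by simp))⟩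
    · rintro ⟨h1, h2⟩ x y (hxy | ⟨hx, hy⟩)
      · exact h1 x y hxy
      · have hx' : x = Fin.last l := Fin.ext (by simpa using hx)
        have hy' : y = 0 := Fin.ext (by simpa using hy)
        rw [hx', hy', h2]
  simp only [Nat.succ_eq_add_one, h]
  rw [Finset.card_eq_sum_card_fiberwise (f := fun f => s (f 0)) (t := Finset.univ)
      (fun _ _ => Finset.mem_coe.2 (Finset.mem_univ _)), Matrix.trace]
  refine Finset.sum_congr rfl fun S _ => ?_
  rw [Matrix.diag_apply, arrowMat_pow_succ_apply]
  congr 1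
  ext f
  simp only [Finset.mem_filter, Finset.mem_univ, true_and]
  constructor
  · rintro ⟨h1, h2, h3, h4⟩
    exact ⟨⟨h1, h2, h4.trans h3.symm⟩, h3⟩
  · rintro ⟨⟨h1, h2, h4⟩, h3⟩
    exact ⟨h1, h2, h3, h4.trans h3⟩

end Walks

/-! ### The transfer matrix as the adjacency matrix of layer colorings -/

section Transfer

variable {n : ℕ}

/-- The matrix that counts the covers of `(S ∪ T)ᶜ` in the grid `T(m_K) × ⟨m_{Kᶜ}⟩`. -/
noncomputable def transferMat (κ : Kind) (K : Set (Fin n)) (m : Fin n → ℕ) :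
    Matrix (Finset (Box m)) (Finset (Box m)) ℕ :=
  fun S T => if Disjoint S T then (coversOf κ K m (S ∪ T)ᶜ).ncard else 0

theorem transferMat_isSymm (κ : Kind) (K : Set (Fin n)) (m : Fin n → ℕ) :
    (transferMat κ K m).IsSymm := by
  ext S T
  rw [Matrix.transpose_apply, transferMat, transferMat, Finset.union_comm T S]
  simp only [disjoint_comm (a := T)]

/-- The embedding of the colors of an `n`-dimensional grid into those of an `(n + 1)`-dimensional
one that skips the direction `p`. -/
def Color.skip (p : Fin (n + 1)) : Color n → Color (n + 1)
  | .fwd k => .fwd (p.succAbove k)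
  | .bwd k => .bwd (p.succAbove k)
  | .mono => .mono

theorem Color.skip_eq_fwd_iff {p : Fin (n + 1)} {c : Color n} {k : Fin n} :
    c.skip p = .fwd (p.succAbove k) ↔ c = .fwd k := by
  cases c <;> simp [Color.skip]

theorem Color.skip_eq_bwd_iff {p : Fin (n + 1)} {c : Color n} {k : Fin n} :
    c.skip p = .bwd (p.succAbove k) ↔ c = .bwd k := by
  cases c <;> simp [Color.skip]

theorem Color.skip_ne_fwd (p : Fin (n + 1)) (c : Color n) : c.skip p ≠ .fwd p := by
  cases c <;> simp [Color.skip, Fin.succAbove_ne]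

theorem Color.skip_ne_bwd (p : Fin (n + 1)) (c : Color n) : c.skip p ≠ .bwd p := by
  cases c <;> simp [Color.skip, Fin.succAbove_ne]

theorem Color.skip_injective (p : Fin (n + 1)) : Function.Injective (Color.skip p) := by
  intro c c' h
  cases c <;> cases c' <;> simp_all [Color.skip]

theorem Color.exists_skip_eq {p : Fin (n + 1)} {c : Color (n + 1)} (h1 : c ≠ .fwd p)
    (h2 : c ≠ .bwd p) : ∃ c', Color.skip p c' = c := by
  cases c with
  | fwd k =>
    obtain ⟨k', rfl⟩ := Fin.exists_succAbove_eq (x := k) (y := p) (by simpa using h1)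
    exact ⟨.fwd k', rfl⟩
  | bwd k =>
    obtain ⟨k', rfl⟩ := Fin.exists_succAbove_eq (x := k) (y := p) (by simpa using h2)
    exact ⟨.bwd k', rfl⟩
  | mono => exact ⟨.mono, rfl⟩

theorem allowed_skip_iff {κ : Kind} {p : Fin (n + 1)} {c : Color n} :
    Allowed κ (c.skip p) ↔ Allowed κ c := by
  cases c <;> simp [Color.skip, Allowed]

/-- The colorings of a layer orthogonal to the direction `p`. -/
def layers (κ : Kind) (p : Fin (n + 1)) (K : Set (Fin n)) (m : Fin n → ℕ)
    (ψ : Box m → Color (n + 1)) : Prop :=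
  (∀ i, Allowed κ (ψ i)) ∧
    ∀ k i j, Step K m k i j → Gam (p.succAbove k) (ψ i) (ψ j)

/-- The points that are covered by dimers from the previous layer. -/
def inSet (p : Fin (n + 1)) {m : Fin n → ℕ} (ψ : Box m → Color (n + 1)) : Finset (Box m) :=
  Finset.univ.filter fun i => ψ i = .bwd p

/-- The points that are covered by dimers to the next layer. -/
def outSet (p : Fin (n + 1)) {m : Fin n → ℕ} (ψ : Box m → Color (n + 1)) : Finset (Box m) :=
  Finset.univ.filter fun i => ψ i = .fwd p

theorem mem_inSet {p : Fin (n + 1)} {m : Fin n → ℕ} {ψ : Box m → Color (n + 1)} {i : Box m} :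
    i ∈ inSet p ψ ↔ ψ i = .bwd p := by simp [inSet]

theorem mem_outSet {p : Fin (n + 1)} {m : Fin n → ℕ} {ψ : Box m → Color (n + 1)} {i : Box m} :
    i ∈ outSet p ψ ↔ ψ i = .fwd p := by simp [outSet]

/-- The coloring of a layer given by a cover of the complement of `S ∪ T`. -/
noncomputable def layerOf (p : Fin (n + 1)) {m : Fin n → ℕ} (S T : Finset (Box m))
    (φ : ((S ∪ T)ᶜ : Finset (Box m)) → Color n) (i : Box m) : Color (n + 1) :=
  if h : i ∈ (S ∪ T)ᶜ then (φ ⟨i, h⟩).skip p else if i ∈ S then .bwd p else .fwd p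

theorem layerOf_of_mem (p : Fin (n + 1)) {m : Fin n → ℕ} {S T : Finset (Box m)}
    (φ : ((S ∪ T)ᶜ : Finset (Box m)) → Color n) {i : Box m} (h : i ∈ (S ∪ T)ᶜ) :
    layerOf p S T φ i = (φ ⟨i, h⟩).skip p := dif_pos h

theorem layerOf_of_mem_left (p : Fin (n + 1)) {m : Fin n → ℕ} {S T : Finset (Box m)}
    (φ : ((S ∪ T)ᶜ : Finset (Box m)) → Color n) {i : Box m} (h : i ∈ S) :
    layerOf p S T φ i = .bwd p := by
  rw [layerOf, dif_neg (by simp [h]), if_pos h]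

theorem layerOf_of_mem_right (p : Fin (n + 1)) {m : Fin n → ℕ} {S T : Finset (Box m)}
    (φ : ((S ∪ T)ᶜ : Finset (Box m)) → Color n) {i : Box m} (hS : i ∉ S) (hT : i ∈ T) :
    layerOf p S T φ i = .fwd p := by
  rw [layerOf, dif_neg (by simp [hT]), if_neg hS]

/-- `layerOf` is the bijection. Points of S and T carry the two colors of direction p, which match
no color of a direction inside the layer, so compatibility across the boundary of the complement
says precisely that no dimer of the cover meets S or T. -/
theorem ncard_coversOf_eq (κ : Kind) (p : Fin (n + 1)) (K : Set (Fin n)) (m : Fin n → ℕ)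
    {S T : Finset (Box m)} (hST : Disjoint S T) :
    (coversOf κ K m (S ∪ T)ᶜ).ncard =
      {ψ | layers κ p K m ψ ∧ inSet p ψ = S ∧ outSet p ψ = T}.ncard := by
  have hinj : Function.Injective (layerOf p S T) := by
    intro φ φ' h
    ext1 ⟨i, hi⟩
    have := congrFun h i
    simp only [layerOf, hi, dif_pos] at this
    exact Color.skip_injective p this
  rw [← Set.ncard_image_of_injective _ hinj]
  congr 1
  have hU : ∀ i : Box m, i ∈ (S ∪ T)ᶜ ↔ i ∉ S ∧ i ∉ T := by simp
  have hU' : ∀ i : Box m, i ∉ (S ∪ T)ᶜ → i ∈ S ∨ i ∉ S ∧ i ∈ T := fun i => by rw [hU]; tauto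
  have hdis : ∀ i, i ∈ S → i ∉ T := fun i hS hT => Finset.disjoint_left.1 hST hS hT
  ext ψ
  constructor
  · rintro ⟨φ, ⟨h1, h2, h3, h4⟩, rfl⟩
    have hout' : ∀ i, i ∉ (S ∪ T)ᶜ →
        layerOf p S T φ i = .bwd p ∨ layerOf p S T φ i = .fwd p := by
      intro i hi
      rcases hU' i hi with h | ⟨h, h'⟩
      · exact Or.inl (layerOf_of_mem_left p φ h)
      · exact Or.inr (layerOf_of_mem_right p φ h h')
    have hnf : ∀ k i, i ∉ (S ∪ T)ᶜ → layerOf p S T φ i ≠ .fwd (p.succAbove k) := by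
      intro k i hi
      rcases hout' i hi with h | h <;> simp [h, (Fin.succAbove_ne p k).symm]
    have hnb : ∀ k i, i ∉ (S ∪ T)ᶜ → layerOf p S T φ i ≠ .bwd (p.succAbove k) := by
      intro k i hi
      rcases hout' i hi with h | h <;> simp [h, (Fin.succAbove_ne p k).symm]
    refine ⟨⟨fun i => ?_, fun k i j hij => ?_⟩, ?_, ?_⟩
    · by_cases hi : i ∈ (S ∪ T)ᶜ
      · rw [layerOf_of_mem p φ hi]
        exact allowed_skip_iff.2 (h1 _)
      · rcases hout' i hi with h | h <;> simp [h, Allowed]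
    · by_cases hi : i ∈ (S ∪ T)ᶜ
      · by_cases hj : j ∈ (S ∪ T)ᶜ
        · rw [layerOf_of_mem p φ hi, layerOf_of_mem p φ hj, Gam, Color.skip_eq_fwd_iff,
            Color.skip_eq_bwd_iff]
          exact h2 k ⟨i, hi⟩ ⟨j, hj⟩ hij
        · refine iff_of_false ?_ (hnb k j hj)
          rw [layerOf_of_mem p φ hi, Color.skip_eq_fwd_iff]
          exact h3 k ⟨i, hi⟩ j hj hij
      · refine iff_of_false (hnf k i hi) ?_
        by_cases hj : j ∈ (S ∪ T)ᶜ
        · rw [layerOf_of_mem p φ hj, Color.skip_eq_bwd_iff]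
          exact h4 k i ⟨j, hj⟩ hi hij
        · exact hnb k j hj
    · ext i
      simp only [inSet, Finset.mem_filter, Finset.mem_univ, true_and]
      by_cases hi : i ∈ (S ∪ T)ᶜ
      · rw [layerOf_of_mem p φ hi]
        exact iff_of_false (Color.skip_ne_bwd _ _) ((hU i).1 hi).1
      · rcases hU' i hi with h | ⟨h, h'⟩
        · simp [layerOf_of_mem_left p φ h, h]
        · simp [layerOf_of_mem_right p φ h h', h]
    · ext i
      simp only [outSet, Finset.mem_filter, Finset.mem_univ, true_and]
      by_cases hi : i ∈ (S ∪ T)ᶜ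
      · rw [layerOf_of_mem p φ hi]
        exact iff_of_false (Color.skip_ne_fwd _ _) ((hU i).1 hi).2
      · rcases hU' i hi with h | ⟨h, h'⟩
        · simp [layerOf_of_mem_left p φ h, hdis i h]
        · simp [layerOf_of_mem_right p φ h h', h']
  · rintro ⟨⟨h1, h2⟩, hS, hT⟩
    have hin : ∀ i, ψ i = .bwd p ↔ i ∈ S := by intro i; simp [← hS, inSet]
    have hout : ∀ i, ψ i = .fwd p ↔ i ∈ T := by intro i; simp [← hT, outSet]
    have hex : ∀ i : ((S ∪ T)ᶜ : Finset (Box m)), ∃ c, Color.skip p c = ψ i := by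
      rintro ⟨i, hi⟩
      rw [hU] at hi
      exact Color.exists_skip_eq (by rw [ne_eq, hout]; exact hi.2) (by rw [ne_eq, hin]; exact hi.1)
    choose φ hφ using hex
    refine ⟨φ, ⟨fun i => ?_, fun k i j hij => ?_, fun k i j hj hij => ?_,
      fun k i j hi hij => ?_⟩, ?_⟩
    · rw [← allowed_skip_iff (p := p), hφ]; exact h1 _
    · have := h2 k i j hij
      rwa [← hφ, ← hφ, Gam, Color.skip_eq_fwd_iff, Color.skip_eq_bwd_iff] at this
    · rw [ne_eq, ← Color.skip_eq_fwd_iff (p := p), hφ]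
      intro h
      have h' := (h2 k i j hij).1 h
      rw [hU, ← hin, ← hout, h'] at hj
      simp [Fin.succAbove_ne] at hj
    · rw [ne_eq, ← Color.skip_eq_bwd_iff (p := p), hφ]
      intro h
      have h' := (h2 k i j hij).2 h
      rw [hU, ← hin, ← hout, h'] at hi
      simp [Fin.succAbove_ne] at hi
    · ext1 i
      by_cases hi : i ∈ (S ∪ T)ᶜ
      · rw [layerOf_of_mem p φ hi, hφ]
      · rcases hU' i hi with h | ⟨h, h'⟩
        · rw [layerOf_of_mem_left p φ h, (hin i).2 h]
        · rw [layerOf_of_mem_right p φ h h', (hout i).2 h']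

/-- The left side does not involve p, so one matrix describes the slicing along every direction. Its
entries vanish for intersecting S and T because a point has only one color. -/
theorem transferMat_eq_arrowMat (κ : Kind) (p : Fin (n + 1)) (K : Set (Fin n)) (m : Fin n → ℕ) :
    transferMat κ K m = arrowMat (layers κ p K m) (inSet p) (outSet p) := by
  classical
  ext S T
  rw [transferMat, arrowMat]
  have hcard : (Finset.univ.filter fun ψ => layers κ p K m ψ ∧ inSet p ψ = S ∧ outSet p ψ = T).card
      = {ψ | layers κ p K m ψ ∧ inSet p ψ = S ∧ outSet p ψ = T}.ncard := by
    rw [← Set.ncard_coe_finset]; simp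
  split_ifs with h
  · rw [ncard_coversOf_eq κ p K m h, ← hcard]
  · symm
    rw [Finset.card_eq_zero, Finset.filter_eq_empty_iff]
    rintro ψ - ⟨-, rfl, rfl⟩
    refine h (Finset.disjoint_left.2 fun i h1 h2 => ?_)
    simp only [inSet, outSet, Finset.mem_filter, Finset.mem_univ, true_and] at h1 h2
    simp [h1] at h2

end Transfer

/-! ### Covers of a grid as walks of layers -/

section Slicing

variable {n : ℕ} {m : Fin (n + 1) → ℕ} (p : Fin (n + 1)) (K : Set (Fin (n + 1)))

/-- The decomposition of a box into layers orthogonal to the direction `p`. -/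
def boxEquiv (m : Fin (n + 1) → ℕ) :
    Fin (m p) × Box (fun j => m (p.succAbove j)) ≃ Box m :=
  Fin.insertNthEquiv (fun k => Fin (m k)) p

theorem boxEquiv_self (x : Fin (m p)) (y : Box fun j => m (p.succAbove j)) :
    boxEquiv p m (x, y) p = x := by simp [boxEquiv]

theorem boxEquiv_succAbove (x : Fin (m p)) (y : Box fun j => m (p.succAbove j)) (j : Fin n) :
    boxEquiv p m (x, y) (p.succAbove j) = y j := by simp [boxEquiv]

theorem step_boxEquiv_self_iff (x x' : Fin (m p)) (y y' : Box fun j => m (p.succAbove j)) :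
    Step K m p (boxEquiv p m (x, y)) (boxEquiv p m (x', y')) ↔
      y = y' ∧ ((x' : ℕ) = x + 1 ∨ p ∈ K ∧ (x : ℕ) + 1 = m p ∧ (x' : ℕ) = 0) := by
  unfold Step
  rw [boxEquiv_self, boxEquiv_self]
  refine and_congr_left fun _ => ?_
  constructor
  · intro h
    ext1 j
    simpa only [boxEquiv_succAbove] using h (p.succAbove j) (Fin.succAbove_ne p j)
  · rintro rfl l hl
    obtain ⟨j, rfl⟩ := Fin.exists_succAbove_eq hl
    rw [boxEquiv_succAbove, boxEquiv_succAbove]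

theorem step_boxEquiv_succAbove_iff (x x' : Fin (m p)) (y y' : Box fun j => m (p.succAbove j))
    (k : Fin n) :
    Step K m (p.succAbove k) (boxEquiv p m (x, y)) (boxEquiv p m (x', y')) ↔
      x = x' ∧ Step {j | p.succAbove j ∈ K} (fun j => m (p.succAbove j)) k y y' := by
  unfold Step
  rw [boxEquiv_succAbove, boxEquiv_succAbove]
  simp only [Set.mem_ofPred_eq]
  rw [← and_assoc (a := x = x')]
  refine and_congr_left fun _ => ?_
  constructor
  · intro h
    refine ⟨by simpa only [boxEquiv_self] using h p (Fin.succAbove_ne p k).symm, fun l hl => ?_⟩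
    simpa only [boxEquiv_succAbove] using h (p.succAbove l) (by simpa using hl)
  · rintro ⟨rfl, h⟩ l hl
    by_cases hp : l = p
    · subst hp; rw [boxEquiv_self, boxEquiv_self]
    · obtain ⟨j, rfl⟩ := Fin.exists_succAbove_eq hp
      rw [boxEquiv_succAbove, boxEquiv_succAbove]
      exact h j (by simpa using hl)

/-- Colorings of a box as sequences of colorings of layers. -/
def slices (m : Fin (n + 1) → ℕ) (C : Type*) :
    (Box m → C) ≃ (Fin (m p) → Box (fun j => m (p.succAbove j)) → C) :=
  ((boxEquiv p m).symm.arrowCongr (Equiv.refl C)).trans (Equiv.curry _ _ _)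

/-- Steps of the grid either stay inside a layer, where they give `layers`, or go to the next layer
at the same point, where compatibility for all points is equality of the outgoing and incoming sets.
-/
theorem mem_perCovers_iff_slices (κ : Kind) (φ : Box m → Color (n + 1)) :
    φ ∈ perCovers κ K m ↔
      (∀ x, layers κ p {j | p.succAbove j ∈ K} (fun j => m (p.succAbove j)) (slices p m _ φ x)) ∧
      ∀ x x' : Fin (m p), ((x' : ℕ) = x + 1 ∨ p ∈ K ∧ (x : ℕ) + 1 = m p ∧ (x' : ℕ) = 0) →
        outSet p (slices p m _ φ x) = inSet p (slices p m _ φ x') := by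
  constructor
  · rintro ⟨h1, h2⟩
    refine ⟨fun x => ⟨fun y => h1 _, fun k y y' hy => ?_⟩, fun x x' hx => ?_⟩
    · exact h2 _ _ _ ((step_boxEquiv_succAbove_iff p K x x y y' k).2 ⟨rfl, hy⟩)
    · ext y
      simp only [outSet, inSet, Finset.mem_filter, Finset.mem_univ, true_and]
      exact h2 _ _ _ ((step_boxEquiv_self_iff p K x x' y y).2 ⟨rfl, hx⟩)
  · rintro ⟨h1, h2⟩
    refine ⟨fun i => ?_, fun k i j hij => ?_⟩
    · obtain ⟨⟨x, y⟩, rfl⟩ := (boxEquiv p m).surjective i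
      exact (h1 x).1 y
    · obtain ⟨⟨x, y⟩, rfl⟩ := (boxEquiv p m).surjective i
      obtain ⟨⟨x', y'⟩, rfl⟩ := (boxEquiv p m).surjective j
      by_cases hk : k = p
      · subst hk
        obtain ⟨rfl, hx⟩ := (step_boxEquiv_self_iff k K x x' y y').1 hij
        have h3 : y ∈ outSet k (slices k m _ φ x) ↔ y ∈ inSet k (slices k m _ φ x') := by
          rw [h2 x x' hx]
        exact mem_outSet.symm.trans (h3.trans mem_inSet)
      · obtain ⟨k', rfl⟩ := Fin.exists_succAbove_eq hk
        obtain ⟨rfl, hy⟩ := (step_boxEquiv_succAbove_iff p K x x' y y' k').1 hij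
        exact (h1 x).2 k' y y' hy

theorem ncard_perCovers_eq_entrySum (κ : Kind) {p : Fin (n + 1)} {K : Set (Fin (n + 1))}
    (hp : p ∉ K) (hm : 0 < m p) :
    (perCovers κ K m).ncard = entrySum (transferMat κ {j | p.succAbove j ∈ K}
      (fun j => m (p.succAbove j)) ^ m p) := by
  classical
  rw [transferMat_eq_arrowMat κ p, entrySum_arrowMat_pow _ _ _ hm,
    ← Set.ncard_image_of_injective _ (slices p m (Color (n + 1))).injective,
    ← Set.ncard_coe_finset]
  congr 1
  ext f
  obtain ⟨φ, rfl⟩ := (slices p m (Color (n + 1))).surjective f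
  rw [(slices p m (Color (n + 1))).injective.mem_set_image, mem_perCovers_iff_slices p]
  simp [hp]

theorem ncard_perCovers_eq_trace (κ : Kind) {p : Fin (n + 1)} {K : Set (Fin (n + 1))}
    (hp : p ∈ K) (hm : 0 < m p) :
    (perCovers κ K m).ncard = (transferMat κ {j | p.succAbove j ∈ K}
      (fun j => m (p.succAbove j)) ^ m p).trace := by
  classical
  rw [transferMat_eq_arrowMat κ p, trace_arrowMat_pow _ _ _ hm,
    ← Set.ncard_image_of_injective _ (slices p m (Color (n + 1))).injective,
    ← Set.ncard_coe_finset]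
  congr 1
  ext f
  obtain ⟨φ, rfl⟩ := (slices p m (Color (n + 1))).surjective f
  rw [(slices p m (Color (n + 1))).injective.mem_set_image, mem_perCovers_iff_slices p]
  simp [hp]

end Slicing

/-! ### Fekete's lemma in several variables -/

section Subadditive

variable {n : ℕ}

theorem vol_pos {m : Fin n → ℕ} (hm : ∀ k, 0 < m k) : 0 < vol m :=
  Finset.prod_pos fun k _ => by exact_mod_cast hm k

theorem vol_update (m : Fin n → ℕ) (k : Fin n) (v : ℕ) :
    vol (Function.update m k v) = v * ∏ l ∈ Finset.univ \ {k}, (m l : ℝ) := by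
  have h : (fun l => ((Function.update m k v l : ℕ) : ℝ)) =
      Function.update (fun l => (m l : ℝ)) k v := by
    ext l
    by_cases hl : l = k
    · subst hl; simp
    · simp [hl]
  unfold vol
  rw [h, Finset.prod_update_of_mem (Finset.mem_univ k)]

theorem vol_eq_mul_prod (m : Fin n → ℕ) (k : Fin n) :
    vol m = m k * ∏ l ∈ Finset.univ \ {k}, (m l : ℝ) := by
  conv_lhs => rw [← Function.update_eq_self k m]
  exact vol_update m k (m k)

theorem vol_insertNth (p : Fin (n + 1)) (L : ℕ) (m : Fin n → ℕ) :
    vol (p.insertNth L m : Fin (n + 1) → ℕ) = L * vol m := by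
  unfold vol
  rw [Fin.prod_univ_succAbove _ p]
  simp

theorem vol_cons (L : ℕ) (m : Fin n → ℕ) :
    vol (Fin.cons L m : Fin (n + 1) → ℕ) = L * vol m := by
  unfold vol
  rw [Fin.prod_univ_succ]
  simp

variable {F : (Fin n → ℕ) → ℝ} {c : ℝ}

theorem update_mul_le
    (hsub : ∀ m k x y, F (Function.update m k (x + y)) ≤
      F (Function.update m k x) + F (Function.update m k y))
    (hc : ∀ m, F m ≤ c * vol m) (m : Fin n → ℕ) (k : Fin n) (a q : ℕ) :
    F (Function.update m k (q * a)) ≤ q * F (Function.update m k a) := by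
  induction q with
  | zero =>
    refine (hc _).trans ?_
    simp [vol_update]
  | succ q ih =>
    rw [Nat.succ_mul]
    refine (hsub m k _ _).trans ?_
    push_cast
    linarith

/-- Divide m k by a with remainder: the full blocks are bounded by subadditivity, and the remainder,
thinner than a, costs at most c times its volume. -/
theorem div_vol_le_update
    (hsub : ∀ m k x y, F (Function.update m k (x + y)) ≤
      F (Function.update m k x) + F (Function.update m k y))
    (h0 : ∀ m, 0 ≤ F m) (hc0 : 0 ≤ c) (hc : ∀ m, F m ≤ c * vol m) {m : Fin n → ℕ}
    (hm : ∀ k, 0 < m k) (k : Fin n) {a : ℕ} (ha : 0 < a) :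
    F m / vol m ≤ F (Function.update m k a) / vol (Function.update m k a) + c * (a / m k) := by
  set V : ℝ := ∏ l ∈ Finset.univ \ {k}, (m l : ℝ) with hV
  have hVpos : 0 < V := Finset.prod_pos fun l _ => by exact_mod_cast hm l
  have hmk : (0 : ℝ) < m k := by exact_mod_cast hm k
  have ha' : (0 : ℝ) < a := by exact_mod_cast ha
  have hsplit : m k / a * a + m k % a = m k := Nat.div_add_mod' _ _
  have h1 : F m ≤ (m k / a : ℕ) * F (Function.update m k a) + c * ((m k % a : ℕ) * V) := by
    have h2 := hsub m k (m k / a * a) (m k % a)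
    rw [hsplit, Function.update_eq_self] at h2
    have h3 := update_mul_le hsub hc m k a (m k / a)
    have h4 := hc (Function.update m k (m k % a))
    rw [vol_update] at h4
    linarith
  have h2 : ((m k / a : ℕ) : ℝ) ≤ m k / a := Nat.cast_div_le
  have h3 : ((m k % a : ℕ) : ℝ) ≤ a := by exact_mod_cast (Nat.mod_lt _ ha).le
  have h4 : F m ≤ m k / a * F (Function.update m k a) + c * (a * V) := by
    refine h1.trans (add_le_add (mul_le_mul_of_nonneg_right h2 (h0 _)) ?_)
    gcongr
  rw [vol_update, ← hV, vol_eq_mul_prod m k, ← hV, div_le_iff₀ (by positivity)]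
  refine h4.trans (le_of_eq ?_)
  field_simp

/-- Replace the coordinates of m by those of a one at a time. The error in direction k does not
depend on the other coordinates, so the errors simply add up. -/
theorem div_vol_le_add_sum
    (hsub : ∀ m k x y, F (Function.update m k (x + y)) ≤
      F (Function.update m k x) + F (Function.update m k y))
    (h0 : ∀ m, 0 ≤ F m) (hc0 : 0 ≤ c) (hc : ∀ m, F m ≤ c * vol m) {m a : Fin n → ℕ}
    (hm : ∀ k, 0 < m k) (ha : ∀ k, 0 < a k) :
    F m / vol m ≤ F a / vol a + ∑ k, c * (a k / m k) := by
  have key : ∀ s : Finset (Fin n), F m / vol m ≤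
      F (s.piecewise a m) / vol (s.piecewise a m) + ∑ k ∈ s, c * (a k / m k) := by
    intro s
    induction s using Finset.induction_on with
    | empty => simp
    | insert k s hk ih =>
      have hpos : ∀ l, 0 < s.piecewise a m l := by
        intro l
        by_cases hl : l ∈ s <;> simp [hl, hm, ha]
      have h := div_vol_le_update hsub h0 hc0 hc hpos k (ha k)
      rw [← Finset.piecewise_insert, Finset.piecewise_eq_of_notMem _ _ _ hk] at h
      rw [Finset.sum_insert hk]
      linarith
  simpa using key Finset.univ

theorem tendsto_eval_atTop (k : Fin n) : Tendsto (fun m : Fin n → ℕ => m k) atTop atTop :=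
  tendsto_atTop.2 fun b => (eventually_ge_atTop fun _ => b).mono fun _ hm => hm k

theorem eventually_forall_lt (b : ℕ) : ∀ᶠ m : Fin n → ℕ in atTop, ∀ k, b < m k :=
  (eventually_ge_atTop fun _ => b + 1).mono fun _ hm k => hm k

/-- Fekete's lemma in several variables. -/
theorem exists_tendsto_div_vol
    (hsub : ∀ m k x y, F (Function.update m k (x + y)) ≤
      F (Function.update m k x) + F (Function.update m k y))
    (h0 : ∀ m, 0 ≤ F m) (hc0 : 0 ≤ c) (hc : ∀ m, F m ≤ c * vol m) :
    ∃ h, Tendsto (fun m => F m / vol m) atTop (𝓝 h) ∧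
      ∀ a : Fin n → ℕ, (∀ k, 0 < a k) → h ≤ F a / vol a := by
  -- The limit will be the infimum of the rates over all boxes with positive sides.
  set s : Set ℝ := (fun m => F m / vol m) '' {a | ∀ k, 0 < a k} with hs
  have hbdd : BddBelow s := by
    refine ⟨0, ?_⟩
    rintro _ ⟨a, ha, rfl⟩
    exact div_nonneg (h0 a) (vol_pos ha).le
  have hne : s.Nonempty := ⟨_, fun _ => 1, fun _ => one_pos, rfl⟩
  have hlow : ∀ a : Fin n → ℕ, (∀ k, 0 < a k) → sInf s ≤ F a / vol a :=
    fun a ha => csInf_le hbdd ⟨a, ha, rfl⟩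
  refine ⟨sInf s, tendsto_order.2 ⟨fun b hb => ?_, fun b hb => ?_⟩, hlow⟩
  · exact (eventually_forall_lt 0).mono fun m hm => hb.trans_le (hlow m hm)
  · obtain ⟨_, ⟨a, ha, rfl⟩, hab⟩ := exists_lt_of_csInf_lt hne hb
    have hlim : Tendsto (fun m : Fin n → ℕ => F a / vol a + ∑ k, c * (a k / m k : ℝ)) atTop
        (𝓝 (F a / vol a + ∑ _k : Fin n, c * 0)) := by
      refine tendsto_const_nhds.add (tendsto_finsetSum _ fun k _ => Tendsto.const_mul _ ?_)
      exact tendsto_const_nhds.div_atTop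
        (tendsto_natCast_atTop_atTop.comp (tendsto_eval_atTop k))
    simp only [mul_zero, Finset.sum_const_zero, add_zero] at hlim
    filter_upwards [hlim.eventually_lt_const hab, eventually_forall_lt 0] with m h1 h2
    exact (div_vol_le_add_sum hsub h0 hc0 hc h2 ha).trans_lt h1

end Subadditive

/-! ### Existence of the entropies, cylinder bounds, and the limit for γ -/

section Limits

variable {n : ℕ} (κ : Kind)

theorem ncard_perCovers_eq_entrySum_of_eq {p : Fin (n + 1)} {K : Set (Fin (n + 1))}
    {K' : Set (Fin n)} {m : Fin (n + 1) → ℕ} {m' : Fin n → ℕ} {L : ℕ} (hp : p ∉ K)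
    (hK : ∀ j, p.succAbove j ∈ K ↔ j ∈ K') (hm : ∀ j, m (p.succAbove j) = m' j) (hL : m p = L)
    (h0 : 0 < L) : (perCovers κ K m).ncard = entrySum (transferMat κ K' m' ^ L) := by
  obtain rfl : m' = fun j => m (p.succAbove j) := funext fun j => (hm j).symm
  obtain rfl : K' = {j | p.succAbove j ∈ K} := Set.ext fun j => (hK j).symm
  subst hL
  exact ncard_perCovers_eq_entrySum κ hp h0

theorem ncard_perCovers_eq_trace_of_eq {p : Fin (n + 1)} {K : Set (Fin (n + 1))}
    {K' : Set (Fin n)} {m : Fin (n + 1) → ℕ} {m' : Fin n → ℕ} {L : ℕ} (hp : p ∈ K)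
    (hK : ∀ j, p.succAbove j ∈ K ↔ j ∈ K') (hm : ∀ j, m (p.succAbove j) = m' j) (hL : m p = L)
    (h0 : 0 < L) : (perCovers κ K m).ncard = (transferMat κ K' m' ^ L).trace := by
  obtain rfl : m' = fun j => m (p.succAbove j) := funext fun j => (hm j).symm
  obtain rfl : K' = {j | p.succAbove j ∈ K} := Set.ext fun j => (hK j).symm
  subst hL
  exact ncard_perCovers_eq_trace κ hp h0

theorem ncard_perCovers_pos {K : Set (Fin n)} {p : Fin n} (hp : p ∉ K) (m : Fin n → ℕ) :
    0 < (perCovers κ K m).ncard := by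
  rw [Set.ncard_pos]
  -- Fill the grid with dimers in the open direction p by pairing layers 2j and 2j + 1; for odd
  -- length the last ones protrude. A periodic direction of odd length would break this pattern.
  refine ⟨fun i => if Even (i p : ℕ) then .fwd p else .bwd p, fun i => ?_, fun k i j hij => ?_⟩
  · dsimp only
    split_ifs <;> simp [Allowed]
  · by_cases hk : k = p
    · subst hk
      have h : (j k : ℕ) = i k + 1 := by
        rcases hij.2 with h | h
        · exact h
        · exact absurd h.1 hp
      by_cases he : Even (i k : ℕ) <;> simp [Gam, h, he, Nat.even_add_one]
    · have hk' : ¬ p = k := fun h => hk h.symm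
      by_cases he : Even (i p : ℕ) <;> by_cases he' : Even (j p : ℕ) <;>
        simp [Gam, he, he', hk']

theorem ncard_perCovers_le (K : Set (Fin n)) (m : Fin n → ℕ) :
    (perCovers κ K m).ncard ≤ Fintype.card (Color n) ^ ∏ k, m k := by
  refine (Set.ncard_le_ncard (Set.subset_univ _)).trans (le_of_eq ?_)
  rw [Set.ncard_univ, Nat.card_eq_fintype_card, Fintype.card_fun, Fintype.card_pi]
  simp

theorem log_ncard_perCovers_le {K : Set (Fin n)} {p : Fin n} (hp : p ∉ K) (m : Fin n → ℕ) :
    Real.log (perCovers κ K m).ncard ≤ Real.log (Fintype.card (Color n)) * vol m := by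
  have h : ((perCovers κ K m).ncard : ℝ) ≤ (Fintype.card (Color n) : ℝ) ^ ∏ k, m k := by
    exact_mod_cast ncard_perCovers_le κ K m
  have h2 := Real.log_le_log (by exact_mod_cast ncard_perCovers_pos κ hp m) h
  rw [Real.log_pow, mul_comm] at h2
  simpa [vol] using h2

theorem ncard_perCovers_update_add_le {K : Set (Fin n)} {p : Fin n} (hp : p ∉ K)
    (m : Fin n → ℕ) (x y : ℕ) : (perCovers κ K (Function.update m p (x + y))).ncard ≤
      (perCovers κ K (Function.update m p x)).ncard *
        (perCovers κ K (Function.update m p y)).ncard := by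
  -- An empty grid has a single cover, while M^0 has one entry 1 per subset, so the entry sum
  -- formula needs positive lengths.
  rcases Nat.eq_zero_or_pos x with rfl | hx
  · rw [zero_add]
    exact Nat.le_mul_of_pos_left _ (ncard_perCovers_pos κ hp _)
  rcases Nat.eq_zero_or_pos y with rfl | hy
  · rw [add_zero]
    exact Nat.le_mul_of_pos_right _ (ncard_perCovers_pos κ hp _)
  obtain ⟨n, rfl⟩ : ∃ n', n = n' + 1 := Nat.exists_eq_succ_of_ne_zero (Fin.pos p).ne'
  have key : ∀ L, 0 < L → (perCovers κ K (Function.update m p L)).ncard =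
      entrySum (transferMat κ {j | p.succAbove j ∈ K} (fun j => m (p.succAbove j)) ^ L) :=
    fun L hL => ncard_perCovers_eq_entrySum_of_eq κ hp (fun _ => Iff.rfl)
      (fun j => by simp [Fin.succAbove_ne]) (by simp) hL
  rw [key _ (by omega), key _ hx, key _ hy]
  exact entrySum_pow_add_le _ _ _

theorem log_ncard_perCovers_nonneg (K : Set (Fin n)) (m : Fin n → ℕ) :
    0 ≤ Real.log (perCovers κ K m).ncard := Real.log_natCast_nonneg _

theorem log_ncard_perCovers_update_add_le {K : Set (Fin n)} {p : Fin n} (hp : p ∉ K)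
    (m : Fin n → ℕ) (x y : ℕ) : Real.log (perCovers κ K (Function.update m p (x + y))).ncard ≤
      Real.log (perCovers κ K (Function.update m p x)).ncard +
        Real.log (perCovers κ K (Function.update m p y)).ncard := by
  have hpos := fun L : ℕ => ncard_perCovers_pos κ hp (Function.update m p L)
  rw [← Real.log_mul (by exact_mod_cast (hpos x).ne') (by exact_mod_cast (hpos y).ne')]
  refine Real.log_le_log (by exact_mod_cast hpos _) ?_
  exact_mod_cast ncard_perCovers_update_add_le κ hp m x y

theorem tendsto_boxRate (n : ℕ) : Tendsto (boxRate κ (n + 1)) atTop (𝓝 (entropy κ (n + 1))) ∧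
    ∀ a : Fin (n + 1) → ℕ, (∀ k, 0 < a k) → entropy κ (n + 1) ≤ boxRate κ (n + 1) a := by
  obtain ⟨h, h1, h2⟩ := exists_tendsto_div_vol
    (F := fun m : Fin (n + 1) → ℕ => Real.log (perCovers κ ∅ m).ncard)
    (c := Real.log (Fintype.card (Color (n + 1))))
    (fun m k x y => log_ncard_perCovers_update_add_le κ (Set.notMem_empty k) m x y)
    (fun m => log_ncard_perCovers_nonneg κ ∅ m) (Real.log_natCast_nonneg _)
    (fun m => log_ncard_perCovers_le κ (Set.notMem_empty 0) m)
  have h3 : Tendsto (boxRate κ (n + 1)) atTop (𝓝 h) := h1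
  have h4 : entropy κ (n + 1) = h := h3.limUnder_eq
  rw [h4]
  exact ⟨h3, h2⟩

theorem tendsto_cylRate (hn : 0 < n) {m₁ : ℕ} (hm : 0 < m₁) :
    Tendsto (cylRate κ n m₁) atTop (𝓝 (cylEntropy κ n m₁)) := by
  have hne : ∀ k : Fin n, k.succ ∉ ({0} : Set (Fin (n + 1))) := fun k => by
    simp [Fin.succ_ne_zero]
  obtain ⟨h, h1, h2⟩ := exists_tendsto_div_vol
    (F := fun m : Fin n → ℕ =>
      Real.log (perCovers κ {0} (Fin.cons m₁ m : Fin (n + 1) → ℕ)).ncard)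
    (c := Real.log (Fintype.card (Color (n + 1))) * m₁)
    (fun m k x y => by
      have hu : ∀ z, (Fin.cons m₁ (Function.update m k z) : Fin (n + 1) → ℕ) =
          Function.update (Fin.cons m₁ m : Fin (n + 1) → ℕ) k.succ z :=
        fun z => Fin.cons_update (α := fun _ => ℕ) m₁ m k z
      rw [hu, hu, hu]
      exact log_ncard_perCovers_update_add_le κ (hne k) _ x y)
    (fun m => log_ncard_perCovers_nonneg κ _ _)
    (mul_nonneg (Real.log_natCast_nonneg _) (Nat.cast_nonneg _))
    (fun m => by
      rw [mul_assoc, ← vol_cons]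
      exact log_ncard_perCovers_le κ (hne ⟨0, hn⟩) _)
  have h3 : Tendsto (cylRate κ n m₁) atTop (𝓝 h) := h1
  rwa [cylEntropy, if_neg hm.ne', h3.limUnder_eq]

/-- Stacking L layers in the open direction p gives exp(h vol m')^L ≤ |V|^2 ρ^L for every L > 0, V
being the set of subsets of a layer; hence the inequality without the constant. -/
theorem exp_le_specRad {h : ℝ} {p : Fin (n + 1)} {K : Set (Fin (n + 1))} {K' : Set (Fin n)}
    (hp : p ∉ K) (hK : ∀ j, p.succAbove j ∈ K ↔ j ∈ K')
    (hcov : ∀ m : Fin (n + 1) → ℕ, (∀ k, 0 < m k) → (∀ k ∈ K, Even (m k)) →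
      Real.exp (h * vol m) ≤ (perCovers κ K m).ncard)
    {m' : Fin n → ℕ} (hm : ∀ k, 0 < m' k) (heven : ∀ k ∈ K', Even (m' k)) :
    Real.exp (h * vol m') ≤ specRad (transferMat κ K' m') := by
  refine le_of_forall_pow_le_mul_pow (c := (Fintype.card (Finset (Box m')) : ℝ) ^ 2)
    (specRad_nonneg _) fun L hL => ?_
  have h1 := hcov (p.insertNth L m')
    (by
      intro k
      rcases Fin.eq_self_or_eq_succAbove p k with rfl | ⟨j, rfl⟩
      · simpa using hL
      · simpa using hm j)
    (by
      intro k hk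
      rcases Fin.eq_self_or_eq_succAbove p k with rfl | ⟨j, rfl⟩
      · exact absurd hk hp
      · simpa using heven j ((hK j).1 hk))
  rw [ncard_perCovers_eq_entrySum_of_eq κ hp hK (m' := m') (by simp) (by simp) hL] at h1
  refine le_trans (le_of_eq ?_) (h1.trans (entrySum_pow_le (transferMat_isSymm κ K' m') L))
  rw [← Real.exp_nat_mul, vol_insertNth]
  ring_nf

/-- The number of covers of a grid that is periodic with even periods is at least as large as the
entropy predicts. -/
theorem exp_entropy_le_ncard_perCovers (K : Set (Fin (n + 1))) {m : Fin (n + 1) → ℕ}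
    (hm : ∀ k, 0 < m k) (heven : ∀ k ∈ K, Even (m k)) :
    Real.exp (entropy κ (n + 1) * vol m) ≤ (perCovers κ K m).ncard := by
  induction K, K.toFinite using Set.Finite.induction_on generalizing m with
  | empty =>
    have h := (tendsto_boxRate κ n).2 m hm
    rw [boxRate, le_div_iff₀ (vol_pos hm)] at h
    rwa [← Real.le_log_iff_exp_le (by
      exact_mod_cast ncard_perCovers_pos κ (Set.notMem_empty 0) m)]
  | @insert p K hp _ ih =>
    -- The induction hypothesis concerns grids in which p is still open and arbitrarily long, which
    -- bounds ρ from below. Making p periodic with even length then replaces the entry sum by a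
    -- trace, which is at least ρ ^ m p.
    have h := exp_le_specRad κ hp (K' := {j | p.succAbove j ∈ K}) (fun _ => Iff.rfl)
      (fun m h1 h2 => ih h1 h2) (m' := fun j => m (p.succAbove j)) (fun k => hm _)
      (fun k hk => heven _ (Or.inr hk))
    rw [ncard_perCovers_eq_trace_of_eq κ (Set.mem_insert p K)
      (K' := {j | p.succAbove j ∈ K}) (by simp [Fin.succAbove_ne]) (fun _ => rfl) rfl (hm p)]
    refine le_trans ?_ (specRad_pow_le_trace (transferMat_isSymm κ _ _)
      (heven p (Set.mem_insert p K)))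
    refine le_trans (le_of_eq ?_) (pow_le_pow_left₀ (Real.exp_pos _).le h _)
    rw [← Real.exp_nat_mul]
    congr 1
    unfold vol
    rw [Fin.prod_univ_succAbove _ p]
    ring

theorem entropy_le_cylEntropy_div (hn : 0 < n) {r : ℕ} (hr : 0 < r) :
    entropy κ (n + 1) ≤ cylEntropy κ n (2 * r) / (2 * r : ℝ) := by
  have hr' : (0 : ℝ) < r := by exact_mod_cast hr
  rw [le_div_iff₀ (by positivity)]
  refine ge_of_tendsto (tendsto_cylRate κ hn (m₁ := 2 * r) (by omega)) ?_
  filter_upwards [eventually_forall_lt 0] with m hm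
  rw [cylRate, le_div_iff₀ (vol_pos hm)]
  have h := exp_entropy_le_ncard_perCovers κ {0} (m := Fin.cons (2 * r) m)
    (fun k => by refine Fin.cases ?_ (fun j => ?_) k <;> simp [hr, hm]) (by simp)
  rw [← Real.le_log_iff_exp_le (by
    exact_mod_cast ncard_perCovers_pos κ (p := Fin.succ ⟨0, hn⟩) (by simp) _),
    vol_cons] at h
  refine le_trans (le_of_eq ?_) h
  push_cast
  ring

theorem exp_entropy_le_specRad_transferMat (K : Set (Fin n)) {m : Fin n → ℕ}
    (hm : ∀ k, 0 < m k) (heven : ∀ k ∈ K, Even (m k)) :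
    Real.exp (entropy κ (n + 1) * vol m) ≤ specRad (transferMat κ K m) :=
  exp_le_specRad κ (p := 0) (K := Fin.succ '' K) (by simp [Fin.succ_ne_zero])
    (by simp) (fun _ h1 h2 => exp_entropy_le_ncard_perCovers κ _ h1 h2) hm heven

theorem entropy_le_log_specRad_div (K : Set (Fin n)) {m : Fin n → ℕ}
    (hm : ∀ k, 0 < m k) (heven : ∀ k ∈ K, Even (m k)) :
    entropy κ (n + 1) ≤ Real.log (specRad (transferMat κ K m)) / vol m := by
  have h := exp_entropy_le_specRad_transferMat κ K hm heven
  rwa [le_div_iff₀ (vol_pos hm), Real.le_log_iff_exp_le ((Real.exp_pos _).trans_le h)]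

theorem specRad_transferMat_empty_pos {m : Fin n → ℕ} (hm : ∀ k, 0 < m k) :
    0 < specRad (transferMat κ ∅ m) :=
  (Real.exp_pos _).trans_le (exp_entropy_le_specRad_transferMat κ ∅ hm (by simp))

/-- The counterpart of `entropy_le_log_specRad_div`: an even power of ρ is bounded by the entry sum,
which counts the covers of a box of that height. -/
theorem log_specRad_div_le_boxRate {m : Fin n → ℕ} (hm : ∀ k, 0 < m k) {r : ℕ} (hr : 0 < r) :
    Real.log (specRad (transferMat κ ∅ m)) / vol m ≤
      boxRate κ (n + 1) (Fin.cons (2 * r) m) := by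
  have hv := vol_pos hm
  have hr' : (0 : ℝ) < r := by exact_mod_cast hr
  have h := specRad_pow_le_entrySum (transferMat_isSymm κ ∅ m) (even_two_mul r)
  rw [← ncard_perCovers_eq_entrySum_of_eq κ (p := 0) (K := ∅)
    (m := (Fin.cons (2 * r) m : Fin (n + 1) → ℕ)) (by simp)
    (by simp) (by simp) (by simp) (by omega)] at h
  have h2 := Real.log_le_log (pow_pos (specRad_transferMat_empty_pos κ hm) _) h
  rw [Real.log_pow] at h2
  rw [boxRate, vol_cons, div_le_div_iff₀ hv (by positivity)]
  calc _ = ((2 * r : ℕ) : ℝ) * Real.log (specRad (transferMat κ ∅ m)) * vol m := by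
        push_cast; ring
    _ ≤ _ := by gcongr

theorem tendsto_log_specRad_div (n : ℕ) :
    Tendsto (fun m : Fin n → ℕ => Real.log (specRad (transferMat κ ∅ m)) / vol m) atTop
      (𝓝 (entropy κ (n + 1))) := by
  refine tendsto_order.2 ⟨fun b hb => ?_, fun b hb => ?_⟩
  · filter_upwards [eventually_forall_lt 0] with m hm
    exact hb.trans_le (entropy_le_log_specRad_div κ ∅ hm (by simp))
  · obtain ⟨N, hN⟩ := eventually_atTop.1 ((tendsto_boxRate κ n).1.eventually_lt_const hb)
    filter_upwards [eventually_forall_lt 0, eventually_ge_atTop fun j => N j.succ] with m h1 h2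
    -- The height 2 (N 0 + 1) is fixed and exceeds N 0, so the box lies in the range where `boxRate`
    -- is already below b.
    refine (log_specRad_div_le_boxRate κ h1 (Nat.succ_pos (N 0))).trans_lt (hN _ fun k => ?_)
    refine Fin.cases ?_ (fun j => ?_) k
    · simp only [Fin.cons_zero]; omega
    · simpa using h2 j

theorem tendsto_log_trace_div (hn : 0 < n) (L : ℕ) :
    Tendsto (fun m : Fin n → ℕ => Real.log ((transferMat κ ∅ m ^ L).trace : ℕ) / vol m) atTop
      (𝓝 (cylEntropy κ n L)) := by
  rcases Nat.eq_zero_or_pos L with rfl | hL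
  -- For L = 0 the trace is the number of subsets of the layer, 2 ^ vol m; this is where the
  -- convention log 2 comes from.
  · rw [cylEntropy, if_pos rfl]
    refine tendsto_const_nhds.congr' ?_
    filter_upwards [eventually_forall_lt 0] with m hm
    have hv := vol_pos hm
    rw [pow_zero, Matrix.trace_one, Fintype.card_finset, Fintype.card_pi, eq_div_iff hv.ne']
    push_cast
    rw [Real.log_pow, mul_comm]
    simp [vol]
  · refine (tendsto_cylRate κ hn hL).congr fun m => ?_
    rw [cylRate, ncard_perCovers_eq_trace_of_eq κ (p := 0) (K' := ∅) (m' := m) (L := L)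
      (Set.mem_singleton 0) (by simp [Fin.succ_ne_zero]) (by simp) (by simp) hL]

theorem trace_transferMat_pow_pos (hn : 0 < n) (m : Fin n → ℕ) (L : ℕ) :
    0 < (transferMat κ ∅ m ^ L).trace := by
  rcases Nat.eq_zero_or_pos L with rfl | hL
  · rw [pow_zero, Matrix.trace_one]
    exact Fintype.card_pos
  · rw [← ncard_perCovers_eq_trace_of_eq κ (p := 0) (K := {0})
      (m := (Fin.cons L m : Fin (n + 1) → ℕ))
      (Set.mem_singleton 0) (by simp [Fin.succ_ne_zero]) (by simp) (by simp) hL]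
    exact ncard_perCovers_pos κ (p := Fin.succ ⟨0, hn⟩) (by simp) _

/-- Take logarithms in `trace_pow_add_le`, divide by the volume of the layer and let the layer grow.
-/
theorem cylEntropy_sub_div_le (hn : 0 < n) {p : ℕ} (hp : 0 < p) (q : ℕ) :
    (cylEntropy κ n (p + 2 * q) - cylEntropy κ n (2 * q)) / (p : ℝ) ≤ entropy κ (n + 1) := by
  have hp' : (0 : ℝ) < p := by exact_mod_cast hp
  rw [div_le_iff₀ hp']
  refine le_of_tendsto_of_tendsto
    ((tendsto_log_trace_div κ hn (p + 2 * q)).sub (tendsto_log_trace_div κ hn (2 * q)))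
    ((tendsto_log_specRad_div κ n).mul_const (p : ℝ)) ?_
  filter_upwards [eventually_forall_lt 0] with m hm
  have hv := vol_pos hm
  have hR := specRad_transferMat_empty_pos κ hm
  have h0 : ∀ L, (0 : ℝ) < ((transferMat κ ∅ m ^ L).trace : ℕ) := fun L => by
    exact_mod_cast trace_transferMat_pow_pos κ hn m L
  have h := Real.log_le_log (h0 _) (trace_pow_add_le (transferMat_isSymm κ ∅ m) p q)
  rw [Real.log_mul (pow_pos hR _).ne' (h0 _).ne', Real.log_pow] at h
  rw [← sub_div, div_mul_eq_mul_div]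
  gcongr
  linarith

end Limits

/-! ### Entrywise comparison of the three matrices -/

section Tilings

variable {n : ℕ} (κ : Kind)

/-- The matrix that counts the tilings of `(S ∪ T)ᶜ` in the grid `T(m_K) × ⟨m_{Kᶜ}⟩`. -/
noncomputable def tilingMat (K : Set (Fin n)) (m : Fin n → ℕ) :
    Matrix (Finset (Box m)) (Finset (Box m)) ℕ :=
  fun S T => if Disjoint S T then (tilingsOf κ K m (S ∪ T)ᶜ).ncard else 0

theorem tilingMat_isSymm (K : Set (Fin n)) (m : Fin n → ℕ) : (tilingMat κ K m).IsSymm := by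
  ext S T
  rw [Matrix.transpose_apply, tilingMat, tilingMat, Finset.union_comm T S]
  simp only [disjoint_comm (a := T)]

theorem alphaRad_eq (m : Fin n → ℕ) : alphaRad κ m = specRad (tilingMat κ ∅ m) := by
  unfold alphaRad specRad
  congr 2
  ext S T
  simp [matA, tilingMat]

theorem betaRad_eq (m : Fin n → ℕ) : betaRad κ m = specRad (tilingMat κ Set.univ m) := by
  unfold betaRad specRad
  congr 2
  ext S T
  simp [matB, tilingMat]

theorem gammaRad_eq (m : Fin n → ℕ) : gammaRad κ m = specRad (transferMat κ ∅ m) := by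
  unfold gammaRad specRad
  congr 2
  ext S T
  simp [matC, transferMat]

theorem Step.mono {K K' : Set (Fin n)} (h : K ⊆ K') {m : Fin n → ℕ} {k : Fin n} {i j : Box m}
    (hij : Step K m k i j) : Step K' m k i j :=
  ⟨hij.1, hij.2.imp_right fun h' => ⟨h h'.1, h'.2⟩⟩

theorem step_empty_iff {m : Fin n → ℕ} {k : Fin n} {i j : Box m} :
    Step ∅ m k i j ↔ (∀ l, l ≠ k → i l = j l) ∧ (j k : ℕ) = i k + 1 := by
  simp [Step]

theorem exists_step_of_val_eq {K : Set (Fin n)} {m : Fin n → ℕ} {k : Fin n} (i : Box m)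
    {v : ℕ} (hv : v < m k) (h : v = (i k : ℕ) + 1 ∨ (k ∈ K ∧ (i k : ℕ) + 1 = m k ∧ v = 0)) :
    ∃ j, Step K m k i j :=
  ⟨Function.update i k ⟨v, hv⟩, fun l hl => by simp [hl], by simpa using h⟩

theorem exists_step_to_of_val_eq {K : Set (Fin n)} {m : Fin n → ℕ} {k : Fin n} (j : Box m)
    {v : ℕ} (hv : v < m k) (h : (j k : ℕ) = v + 1 ∨ (k ∈ K ∧ v + 1 = m k ∧ (j k : ℕ) = 0)) :
    ∃ i, Step K m k i j :=
  ⟨Function.update j k ⟨v, hv⟩, fun l hl => by simp [hl], by simpa using h⟩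

/-- On a full torus every point has a neighbor in each direction, so no dimer can protrude. -/
theorem tilingsOf_univ_eq (m : Fin n → ℕ) (U : Finset (Box m)) :
    tilingsOf κ Set.univ m U = coversOf κ Set.univ m U := by
  refine Set.Subset.antisymm (fun φ h => h.1) fun φ h => ⟨h, fun k i _ => ?_, fun k j _ => ?_⟩
  · have hi := (i.1 k).2
    by_cases h1 : (i.1 k : ℕ) + 1 = m k
    · exact exists_step_of_val_eq i.1 (v := 0) (by omega) (Or.inr ⟨Set.mem_univ _, h1, rfl⟩)
    · exact exists_step_of_val_eq i.1 (v := (i.1 k : ℕ) + 1) (by omega) (Or.inl rfl)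
  · have hj := (j.1 k).2
    by_cases h1 : (j.1 k : ℕ) = 0
    · exact exists_step_to_of_val_eq j.1 (v := m k - 1) (by omega)
        (Or.inr ⟨Set.mem_univ _, by omega, h1⟩)
    · exact exists_step_to_of_val_eq j.1 (v := (j.1 k : ℕ) - 1) (by omega) (Or.inl (by omega))

theorem tilingMat_univ_eq (m : Fin n → ℕ) :
    tilingMat κ Set.univ m = transferMat κ Set.univ m := by
  ext S T
  simp only [tilingMat, transferMat, tilingsOf_univ_eq]

theorem coversOf_univ_subset (m : Fin n → ℕ) (U : Finset (Box m)) :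
    coversOf κ Set.univ m U ⊆ coversOf κ ∅ m U := fun _ h =>
  ⟨h.1, fun k i j hij => h.2.1 k i j (hij.mono (Set.empty_subset _)),
    fun k i j hj hij => h.2.2.1 k i j hj (hij.mono (Set.empty_subset _)),
    fun k i j hi hij => h.2.2.2 k i j hi (hij.mono (Set.empty_subset _))⟩

/-- A tiling of the box has no outward color on its boundary layers, so both sides of each
additional wraparound condition are false. -/
theorem tilingsOf_empty_subset (m : Fin n → ℕ) (U : Finset (Box m)) :
    tilingsOf κ ∅ m U ⊆ tilingsOf κ Set.univ m U := by
  rw [tilingsOf_univ_eq]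
  rintro φ ⟨⟨h1, h2, h3, h4⟩, h5, h6⟩
  have hf : ∀ k (i : U), (i.1 k : ℕ) + 1 = m k → φ i ≠ .fwd k := by
    intro k i hi h
    obtain ⟨j, hj⟩ := h5 k i h
    have h7 := (step_empty_iff.1 hj).2
    have := (j k).2
    omega
  have hb : ∀ k (j : U), (j.1 k : ℕ) = 0 → φ j ≠ .bwd k := by
    intro k j hj h
    obtain ⟨i, hi⟩ := h6 k j h
    have h7 := (step_empty_iff.1 hi).2
    omega
  refine ⟨h1, fun k i j hij => ?_, fun k i j hj hij => ?_, fun k i j hi hij => ?_⟩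
  · rcases hij.2 with h | h
    · exact h2 k i j ⟨hij.1, Or.inl h⟩
    · exact iff_of_false (hf k i h.2.1) (hb k j h.2.2)
  · rcases hij.2 with h | h
    · exact h3 k i j hj ⟨hij.1, Or.inl h⟩
    · exact hf k i h.2.1
  · rcases hij.2 with h | h
    · exact h4 k i j hi ⟨hij.1, Or.inl h⟩
    · exact hb k j h.2.2

theorem alphaRad_le_betaRad (m : Fin n → ℕ) : alphaRad κ m ≤ betaRad κ m := by
  rw [alphaRad_eq, betaRad_eq]
  refine specRad_le_of_embedding (tilingMat_isSymm κ _ m) (tilingMat_isSymm κ _ m)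
    Function.injective_id fun S T => ?_
  simp only [tilingMat, id]
  split_ifs
  · exact Set.ncard_le_ncard (tilingsOf_empty_subset κ m _)
  · exact le_rfl

theorem betaRad_le_gammaRad (m : Fin n → ℕ) : betaRad κ m ≤ gammaRad κ m := by
  rw [betaRad_eq, gammaRad_eq, tilingMat_univ_eq]
  refine specRad_le_of_embedding (transferMat_isSymm κ _ m) (transferMat_isSymm κ _ m)
    Function.injective_id fun S T => ?_
  simp only [transferMat, id]
  split_ifs
  · exact Set.ncard_le_ncard (coversOf_univ_subset κ m _)
  · exact le_rfl

end Tilings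

/-! ### Absorbing protruding dimers in a collar -/

section Collar

variable {n : ℕ} {m : Fin n → ℕ}

/-- The embedding of a box into the box that has one more layer on each side. -/
def grow (i : Box m) : Box (fun k => m k + 2) := fun k => 
  ⟨i k + 1, Nat.succ_lt_succ (Nat.lt_succ_of_lt (i k).2)⟩

theorem grow_val (i : Box m) (k : Fin n) : (grow i k : ℕ) = i k + 1 := rfl

theorem grow_injective : Function.Injective (grow (m := m)) := by
  intro i j h
  ext k
  have := congrArg Fin.val (congrFun h k)
  simpa [grow_val] using this

/-- The embedding `grow` acting on subsets. -/
def growSet (S : Finset (Box m)) : Finset (Box fun k => m k + 2) := S.map ⟨grow, grow_injective⟩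

theorem mem_growSet {S : Finset (Box m)} {z : Box fun k => m k + 2} :
    z ∈ growSet S ↔ ∃ i ∈ S, grow i = z := by simp [growSet]

theorem grow_mem_growSet {S : Finset (Box m)} {i : Box m} : grow i ∈ growSet S ↔ i ∈ S := by
  simp [mem_growSet, grow_injective.eq_iff]

theorem growSet_injective : Function.Injective (growSet (m := m)) := Finset.map_injective _

variable (m) in
/-- The outermost layers of the larger box. -/
def collar : Finset (Box fun k => m k + 2) := (growSet Finset.univ)ᶜ

theorem mem_collar {z : Box fun k => m k + 2} : z ∈ collar m ↔ ∀ i, grow i ≠ z := by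
  simp [collar, mem_growSet]

variable (m) in
theorem card_collar_add : (collar m).card + ∏ k, m k = ∏ k, (m k + 2) := by
  have h := Finset.card_compl_add_card (growSet (Finset.univ : Finset (Box m)))
  rw [growSet, Finset.card_map, Finset.card_univ, Fintype.card_pi, Fintype.card_pi] at h
  simpa [collar, growSet] using h

/-- The points outside the box that are covered by the dimers that protrude out of it. -/
def protrusion {U : Finset (Box m)} (φ : U → Color n) : Finset (Box fun k => m k + 2) :=
  Finset.univ.filter fun z => ∃ (i : U) (k : Fin n), (∀ l, l ≠ k → (z l : ℕ) = i.1 l + 1) ∧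
    ((φ i = .fwd k ∧ (i.1 k : ℕ) + 1 = m k ∧ (z k : ℕ) = m k + 1) ∨
      (φ i = .bwd k ∧ (i.1 k : ℕ) = 0 ∧ (z k : ℕ) = 0))

theorem protrusion_subset_collar {U : Finset (Box m)} (φ : U → Color n) :
    protrusion φ ⊆ collar m := by
  intro z hz
  simp only [protrusion, Finset.mem_filter, Finset.mem_univ, true_and] at hz
  obtain ⟨i, k, -, h⟩ := hz
  rw [mem_collar]
  rintro j rfl
  have h1 := (j k).2
  rw [grow_val] at h
  omega

open Classical in
/-- The extension of a cover to the points outside the box that its dimers reach. -/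
noncomputable def extend {U : Finset (Box m)} {U' : Finset (Box fun k => m k + 2)}
    (φ : U → Color n) (z : U') : Color n :=
  if h : ∃ i : U, grow i.1 = z.1 then φ h.choose
  -- A point reached by a protruding dimer has exactly one coordinate equal to 0 or m k + 1, so its
  -- direction and color can be read off from the point alone.
  else if h : ∃ k, (z.1 k : ℕ) = 0 then .fwd h.choose
  else if h : ∃ k, (z.1 k : ℕ) = m k + 1 then .bwd h.choose
  else .mono

section Extend

variable {U : Finset (Box m)} {U' : Finset (Box fun k => m k + 2)} {φ : U → Color n}

theorem extend_grow (φ : U → Color n) (i : U) (h : grow i.1 ∈ U') :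
    extend φ (⟨grow i.1, h⟩ : U') = φ i := by
  have hex : ∃ j : U, grow j.1 = grow i.1 := ⟨i, rfl⟩
  rw [extend, dif_pos hex]
  congr 1
  exact Subtype.ext (grow_injective hex.choose_spec)

theorem extend_of_mem_protrusion {z : U'} (hz : z.1 ∈ protrusion φ) :
    ∃ (i : U) (k : Fin n), (∀ l, l ≠ k → (z.1 l : ℕ) = i.1 l + 1) ∧
      ((φ i = .fwd k ∧ (i.1 k : ℕ) + 1 = m k ∧ (z.1 k : ℕ) = m k + 1 ∧ extend φ z = .bwd k) ∨
        (φ i = .bwd k ∧ (i.1 k : ℕ) = 0 ∧ (z.1 k : ℕ) = 0 ∧ extend φ z = .fwd k)) := by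
  have hc := mem_collar.1 (protrusion_subset_collar φ hz)
  have hn : ¬ ∃ i : U, grow i.1 = z.1 := fun ⟨i, hi⟩ => hc _ hi
  simp only [protrusion, Finset.mem_filter, Finset.mem_univ, true_and] at hz
  obtain ⟨i, k, h1, h2⟩ := hz
  refine ⟨i, k, h1, ?_⟩
  rcases h2 with ⟨h2, h3, h4⟩ | ⟨h2, h3, h4⟩
  · refine Or.inl ⟨h2, h3, h4, ?_⟩
    have h5 : ¬ ∃ l, (z.1 l : ℕ) = 0 := by
      rintro ⟨l, hl⟩
      by_cases hlk : l = k
      · subst hlk; omega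
      · have := h1 l hlk; omega
    have h6 : ∃ l, (z.1 l : ℕ) = m l + 1 := ⟨k, h4⟩
    rw [extend, dif_neg hn, dif_neg h5, dif_pos h6]
    congr 1
    by_contra hne
    have h7 := h1 _ hne
    have h8 := h6.choose_spec
    have h9 := (i.1 h6.choose).2
    omega
  · refine Or.inr ⟨h2, h3, h4, ?_⟩
    have h6 : ∃ l, (z.1 l : ℕ) = 0 := ⟨k, h4⟩
    rw [extend, dif_neg hn, dif_pos h6]
    congr 1
    by_contra hne
    have h7 := h1 _ hne
    have h8 := h6.choose_spec
    omega

/-- The points at which the extension of a cover is defined. -/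
theorem extend_cases (hU' : ∀ z, z ∈ U' ↔ z ∈ growSet U ∨ z ∈ protrusion φ) (z : U') :
    (∃ i : U, z.1 = grow i.1 ∧ extend φ z = φ i) ∨
    ∃ (i : U) (k : Fin n), (∀ l, l ≠ k → (z.1 l : ℕ) = i.1 l + 1) ∧
      ((φ i = .fwd k ∧ (i.1 k : ℕ) + 1 = m k ∧ (z.1 k : ℕ) = m k + 1 ∧ extend φ z = .bwd k) ∨
        (φ i = .bwd k ∧ (i.1 k : ℕ) = 0 ∧ (z.1 k : ℕ) = 0 ∧ extend φ z = .fwd k)) := by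
  obtain ⟨z, hz⟩ := z
  rcases (hU' z).1 hz with h | h
  · obtain ⟨i, hi, rfl⟩ := mem_growSet.1 h
    exact Or.inl ⟨⟨i, hi⟩, rfl, extend_grow φ ⟨i, hi⟩ hz⟩
  · exact Or.inr (extend_of_mem_protrusion h)

theorem step_grow_iff {k : Fin n} {i j : Box m} :
    Step ∅ (fun k => m k + 2) k (grow i) (grow j) ↔ Step ∅ m k i j := by
  simp only [step_empty_iff, grow_val, Fin.ext_iff, add_left_inj]

/-- The outer half of each protruding dimer is added to the set, so the dimer becomes an ordinary
one of the larger box. No other collar point is used, so nothing protrudes any more. -/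
theorem extend_mem_tilingsOf {κ : Kind} (hφ : φ ∈ coversOf κ ∅ m U)
    (hU' : ∀ z, z ∈ U' ↔ z ∈ growSet U ∨ z ∈ protrusion φ) :
    (extend φ : U' → Color n) ∈ tilingsOf κ ∅ (fun k => m k + 2) U' := by
  obtain ⟨h1, h2, h3, h4⟩ := hφ
  have hmem : ∀ i : U, grow i.1 ∈ U' := fun i => (hU' _).2 (Or.inl (grow_mem_growSet.2 i.2))
  refine ⟨⟨fun z => ?_, fun k z w hzw => ?_, fun k z w hw hzw => ?_, fun k z w hz hzw => ?_⟩,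
    fun k z hz => ?_, fun k z hz => ?_⟩
  · rcases extend_cases hU' z with ⟨i, -, h⟩ | ⟨i, k, -, ⟨-, -, -, h⟩ | ⟨-, -, -, h⟩⟩
    · rw [h]; exact h1 i
    · simp [h, Allowed]
    · simp [h, Allowed]
  · obtain ⟨hl, hk⟩ := step_empty_iff.1 hzw
    simp only [Fin.ext_iff] at hl
    rcases extend_cases hU' z with ⟨i, hzi, hz⟩ | ⟨i, k', hz1, hz2⟩ <;>
      rcases extend_cases hU' w with ⟨j, hwj, hw⟩ | ⟨j, k'', hw1, hw2⟩
    · rw [hzi, hwj, step_grow_iff] at hzw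
      rw [hz, hw]
      exact h2 k i j hzw
    · rw [hzi] at hl hk
      simp only [grow_val] at hl hk
      have hkk : k'' = k := by
        by_contra hne
        have h5 := hl k'' hne
        have h6 := (i.1 k'').2
        omega
      subst hkk
      rcases hw2 with ⟨e1, e2, e3, e4⟩ | ⟨e1, e2, e3, e4⟩
      · have hij : i = j := by
          refine Subtype.ext (funext fun l => Fin.ext ?_)
          by_cases hlk : l = k''
          · subst hlk; omega
          · have := hl l hlk; have := hw1 l hlk; omega
        subst hij
        rw [hz, e1, e4]
        simp [Gam]
      · omega
    · rw [hwj] at hl hk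
      simp only [grow_val] at hl hk
      have hkk : k' = k := by
        by_contra hne
        have h5 := hl k' hne
        have h6 := (j.1 k').2
        omega
      subst hkk
      have h6 := (j.1 k').2
      rcases hz2 with ⟨e1, e2, e3, e4⟩ | ⟨e1, e2, e3, e4⟩
      · omega
      · have hij : i = j := by
          refine Subtype.ext (funext fun l => Fin.ext ?_)
          by_cases hlk : l = k'
          · subst hlk; omega
          · have := hl l hlk; have := hz1 l hlk; omega
        subst hij
        rw [hw, e1, e4]
        simp [Gam]
    -- Two adjacent collar points never form a dimer: the partner of a reached point is always
    -- inside the box.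
    · have hi := (i.1 k).2
      refine iff_of_false (fun h => ?_) fun h => ?_
      · have hkk : k' = k := by
          rcases hz2 with ⟨-, -, -, e4⟩ | ⟨-, -, -, e4⟩ <;> simp [e4] at h
          exact h
        subst hkk
        have e3 : (z.1 k' : ℕ) = 0 := by
          rcases hz2 with ⟨-, -, -, e4⟩ | ⟨-, -, e3, -⟩
          · simp [e4] at h
          · exact e3
        by_cases hne : k'' = k'
        · subst hne; omega
        · have h5 := hl k'' hne
          have h6 := hz1 k'' hne
          have h7 := (i.1 k'').2
          omega
      · have hkk : k'' = k := by
          rcases hw2 with ⟨-, -, -, e4⟩ | ⟨-, -, -, e4⟩ <;> simp [e4] at h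
          exact h
        subst hkk
        have e3 : (w.1 k'' : ℕ) = m k'' + 1 := by
          rcases hw2 with ⟨-, -, e3, -⟩ | ⟨-, -, -, e4⟩
          · exact e3
          · simp [e4] at h
        by_cases hne : k' = k''
        · subst hne; omega
        · have h5 := hl k' hne
          have h6 := hw1 k' hne
          have h7 := (j.1 k').2
          omega
  · intro h
    obtain ⟨hl, hk⟩ := step_empty_iff.1 hzw
    simp only [Fin.ext_iff] at hl
    rcases extend_cases hU' z with ⟨i, hzi, hz⟩ | ⟨i, k', hz1, hz2⟩
    · rw [hz] at h
      rw [hzi] at hl hk hzw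
      simp only [grow_val] at hl hk
      by_cases hik : (i.1 k : ℕ) + 1 = m k
      · refine hw ((hU' w).2 (Or.inr ?_))
        simp only [protrusion, Finset.mem_filter, Finset.mem_univ, true_and]
        exact ⟨i, k, fun l hlk => (hl l hlk).symm, Or.inl ⟨h, hik, by omega⟩⟩
      · have hik' := (i.1 k).2
        obtain ⟨j, hj⟩ := exists_step_of_val_eq (K := ∅) i.1 (k := k) (v := i.1 k + 1) (by omega)
          (Or.inl rfl)
        have hwj : w = grow j := by
          have h5 := step_empty_iff.1 hj
          refine funext fun l => Fin.ext ?_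
          rw [grow_val]
          by_cases hlk : l = k
          · subst hlk; omega
          · rw [← hl l hlk, h5.1 l hlk]
        subst hwj
        exact h3 k i j (fun hj' => hw (hmem ⟨j, hj'⟩)) hj h
    · rcases hz2 with ⟨-, -, -, e4⟩ | ⟨e1, e2, e3, e4⟩
      · simp [e4] at h
      · obtain rfl : k' = k := by simpa [e4] using h
        refine hw ?_
        have hwi : w = grow i.1 := by
          refine funext fun l => Fin.ext ?_
          rw [grow_val]
          by_cases hlk : l = k'
          · subst hlk; omega
          · rw [← hl l hlk, hz1 l hlk]
        rw [hwi]
        exact hmem i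
  · intro h
    obtain ⟨hl, hk⟩ := step_empty_iff.1 hzw
    simp only [Fin.ext_iff] at hl
    rcases extend_cases hU' w with ⟨j, hwj, hw⟩ | ⟨j, k', hw1, hw2⟩
    · rw [hw] at h
      rw [hwj] at hl hk hzw
      simp only [grow_val] at hl hk
      by_cases hjk : (j.1 k : ℕ) = 0
      · refine hz ((hU' z).2 (Or.inr ?_))
        simp only [protrusion, Finset.mem_filter, Finset.mem_univ, true_and]
        exact ⟨j, k, fun l hlk => hl l hlk, Or.inr ⟨h, hjk, by omega⟩⟩
      · have hjk' := (j.1 k).2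
        obtain ⟨i, hi⟩ := exists_step_to_of_val_eq (K := ∅) j.1 (k := k) (v := j.1 k - 1)
          (by omega) (Or.inl (by omega))
        have hzi : z = grow i := by
          have h5 := step_empty_iff.1 hi
          refine funext fun l => Fin.ext ?_
          rw [grow_val]
          by_cases hlk : l = k
          · subst hlk; omega
          · rw [hl l hlk, h5.1 l hlk]
        subst hzi
        exact h4 k i j (fun hi' => hz (hmem ⟨i, hi'⟩)) hi h
    · rcases hw2 with ⟨e1, e2, e3, e4⟩ | ⟨-, -, -, e4⟩
      · obtain rfl : k' = k := by simpa [e4] using h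
        refine hz ?_
        have hzi : z = grow j.1 := by
          refine funext fun l => Fin.ext ?_
          rw [grow_val]
          by_cases hlk : l = k'
          · subst hlk; omega
          · rw [hl l hlk, hw1 l hlk]
        rw [hzi]
        exact hmem j
      · simp [e4] at h
  · refine exists_step_of_val_eq z.1 (v := z.1 k + 1) ?_ (Or.inl rfl)
    rcases extend_cases hU' z with ⟨i, hzi, -⟩ | ⟨i, k', hz1, ⟨-, -, -, e4⟩ | ⟨-, -, e3, e4⟩⟩
    · have := (i.1 k).2
      rw [hzi, grow_val]
      omega
    · simp [e4] at hz
    · obtain rfl : k' = k := by simpa [e4] using hz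
      omega
  · refine exists_step_to_of_val_eq z.1 (v := z.1 k - 1) ((Nat.sub_le _ _).trans_lt (z.1 k).2)
      (Or.inl ?_)
    rcases extend_cases hU' z with ⟨i, hzi, -⟩ | ⟨i, k', hz1, ⟨-, -, e3, e4⟩ | ⟨-, -, -, e4⟩⟩
    · rw [hzi, grow_val]
      omega
    · obtain rfl : k' = k := by simpa [e4] using hz
      omega
    · simp [e4] at hz

end Extend

theorem ncard_coversOf_protrusion_le (κ : Kind) {U : Finset (Box m)}
    {U' P : Finset (Box fun k => m k + 2)} (hU' : ∀ z, z ∈ U' ↔ z ∈ growSet U ∨ z ∈ P) :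
    {φ | φ ∈ coversOf κ ∅ m U ∧ protrusion φ = P}.ncard ≤
      (tilingsOf κ ∅ (fun k => m k + 2) U').ncard := by
  refine Set.ncard_le_ncard_of_injOn (fun φ => extend φ) ?_ ?_
  · rintro φ ⟨hφ, rfl⟩
    exact extend_mem_tilingsOf hφ hU'
  · intro φ _ φ' _ h
    ext1 i
    have hi : grow i.1 ∈ U' := (hU' _).2 (Or.inl (grow_mem_growSet.2 i.2))
    have := congrFun h ⟨grow i.1, hi⟩
    simpa only [extend_grow] using this

/-- The matrix that counts the covers of `(S ∪ T)ᶜ` with a given protrusion. -/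
noncomputable def protrusionMat (κ : Kind) (P : Finset (Box fun k => m k + 2)) :
    Matrix (Finset (Box m)) (Finset (Box m)) ℕ :=
  fun S T => if Disjoint S T then
    {φ : ((S ∪ T)ᶜ : Finset (Box m)) → Color n |
      φ ∈ coversOf κ ∅ m (S ∪ T)ᶜ ∧ protrusion φ = P}.ncard else 0

theorem protrusionMat_isSymm (κ : Kind) (P : Finset (Box fun k => m k + 2)) :
    (protrusionMat κ P).IsSymm := by
  ext S T
  rw [Matrix.transpose_apply, protrusionMat, protrusionMat, Finset.union_comm T S]
  simp only [disjoint_comm (a := T)]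

theorem transferMat_eq_sum_protrusionMat (κ : Kind) (m : Fin n → ℕ) :
    transferMat κ ∅ m = ∑ P ∈ (collar m).powerset, protrusionMat κ P := by
  classical
  ext S T
  rw [Matrix.sum_apply]
  simp only [transferMat, protrusionMat]
  split_ifs with h
  · have hcard : ∀ X : Set (((S ∪ T)ᶜ : Finset (Box m)) → Color n),
        X.ncard = (Finset.univ.filter fun φ => φ ∈ X).card := fun X => by
      rw [← Set.ncard_coe_finset]; simp
    rw [hcard, Finset.card_eq_sum_card_fiberwise (f := fun φ => protrusion φ)
      (t := (collar m).powerset)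
      (fun φ _ => Finset.mem_coe.2 (Finset.mem_powerset.2 (protrusion_subset_collar φ)))]
    refine Finset.sum_congr rfl fun P _ => ?_
    rw [hcard, Finset.filter_filter]
    congr 1
    ext φ
    simp
  · simp

/-- The collar points not in P must be excluded from the tiling, so they are put into one of the two
index sets. Putting them only into the second keeps the sets disjoint, but rows and columns are now
embedded differently. -/
theorem protrusionMat_le_tilingMat (κ : Kind) {P : Finset (Box fun k => m k + 2)}
    (hP : P ⊆ collar m) (S T : Finset (Box m)) :
    protrusionMat κ P S T ≤ tilingMat κ ∅ (fun k => m k + 2) (growSet S)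
      (growSet T ∪ collar m \ P) := by
  by_cases h : Disjoint S T
  · have hd : Disjoint (growSet S) (growSet T ∪ collar m \ P) := by
      rw [Finset.disjoint_left]
      intro z hz hz'
      obtain ⟨i, hi, rfl⟩ := mem_growSet.1 hz
      rcases Finset.mem_union.1 hz' with h1 | h1
      · exact Finset.disjoint_left.1 h hi (grow_mem_growSet.1 h1)
      · exact mem_collar.1 (Finset.mem_sdiff.1 h1).1 i rfl
    rw [protrusionMat, tilingMat, if_pos h, if_pos hd]
    refine ncard_coversOf_protrusion_le κ fun z => ?_
    by_cases hz : z ∈ collar m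
    · have h1 : ∀ S : Finset (Box m), z ∉ growSet S := fun S hz' => by
        obtain ⟨i, -, hi⟩ := mem_growSet.1 hz'
        exact mem_collar.1 hz i hi
      simp [h1, hz]
    · have hzP : z ∉ P := fun h' => hz (hP h')
      obtain ⟨i, rfl⟩ : ∃ i, grow i = z := by
        by_contra hne
        exact hz (mem_collar.2 fun i hi => hne ⟨i, hi⟩)
      simp [hz, hzP, grow_mem_growSet]
  · rw [protrusionMat, if_neg h]
    exact Nat.zero_le _

/-- Squaring repairs the asymmetry: in a two-step walk S, T, S' both ends are embedded by `growSet`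
and only the middle vertex receives the rest of the collar. Symmetry of the matrices supplies the
second step. -/
theorem specRad_protrusionMat_le (κ : Kind) {P : Finset (Box fun k => m k + 2)}
    (hP : P ⊆ collar m) :
    specRad (protrusionMat κ P) ≤ specRad (tilingMat κ ∅ fun k => m k + 2) := by
  have hs := protrusionMat_isSymm κ P
  have hs' := tilingMat_isSymm κ ∅ fun k => m k + 2
  have hinj : Function.Injective fun T : Finset (Box m) => growSet T ∪ collar m \ P := by
    intro T T' h
    ext i
    have hi : grow i ∉ collar m := fun h' => mem_collar.1 h' i rfl
    have h2 : grow i ∈ growSet T ∪ collar m \ P ↔ grow i ∈ growSet T' ∪ collar m \ P := by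
      rw [show growSet T ∪ collar m \ P = growSet T' ∪ collar m \ P from h]
    simpa [hi, grow_mem_growSet] using h2
  have key : specRad (protrusionMat κ P) ^ 2 ≤ specRad (tilingMat κ ∅ fun k => m k + 2) ^ 2 := by
    rw [← specRad_sq hs, ← specRad_sq hs']
    refine specRad_le_of_embedding (hs.pow 2) (hs'.pow 2) growSet_injective fun S S' => ?_
    rw [sq, sq, Matrix.mul_apply, Matrix.mul_apply]
    calc _ ≤ ∑ T, tilingMat κ ∅ (fun k => m k + 2) (growSet S) (growSet T ∪ collar m \ P) *
          tilingMat κ ∅ (fun k => m k + 2) (growSet T ∪ collar m \ P) (growSet S') := by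
          refine Finset.sum_le_sum fun T _ =>
            Nat.mul_le_mul (protrusionMat_le_tilingMat κ hP S T) ?_
          rw [← hs.apply, ← hs'.apply]
          exact protrusionMat_le_tilingMat κ hP S' T
      _ = ∑ R ∈ Finset.univ.map ⟨_, hinj⟩, tilingMat κ ∅ (fun k => m k + 2) (growSet S) R *
          tilingMat κ ∅ (fun k => m k + 2) R (growSet S') := by simp
      _ ≤ _ := Finset.sum_le_sum_of_subset (Finset.subset_univ _)
  exact (pow_le_pow_iff_left₀ (specRad_nonneg _) (specRad_nonneg _) two_ne_zero).1 key

/-- Sort the covers by their protrusion, one of the 2^c subsets of the collar, and use subadditivity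
of the norm. -/
theorem gammaRad_le_two_pow_mul_alphaRad (κ : Kind) (m : Fin n → ℕ) :
    gammaRad κ m ≤ 2 ^ (collar m).card * alphaRad κ fun k => m k + 2 := by
  rw [gammaRad_eq, alphaRad_eq, transferMat_eq_sum_protrusionMat]
  refine (specRad_sum_le _ _ fun P _ => protrusionMat_isSymm κ P).trans ?_
  refine (Finset.sum_le_sum fun P hP =>
    specRad_protrusionMat_le κ (Finset.mem_powerset.1 hP)).trans (le_of_eq ?_)
  rw [Finset.sum_const, Finset.card_powerset, nsmul_eq_mul]
  push_cast
  rfl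

end Collar

/-! ### Limits for α and β by squeezing -/

section Limits

variable {n : ℕ} (κ : Kind)

theorem gammaRad_pos {m : Fin n → ℕ} (hm : ∀ k, 0 < m k) : 0 < gammaRad κ m := by
  rw [gammaRad_eq]
  exact specRad_transferMat_empty_pos κ hm

theorem log_alphaRad_ge {m : Fin n → ℕ} (hm : ∀ k, 0 < m k) :
    0 < alphaRad κ (fun k => m k + 2) ∧
    entropy κ (n + 1) * vol m - (vol (fun k => m k + 2) - vol m) * Real.log 2 ≤
      Real.log (alphaRad κ fun k => m k + 2) := by
  have h := gammaRad_le_two_pow_mul_alphaRad κ m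
  have hγ := gammaRad_pos κ hm
  have hα : 0 < alphaRad κ fun k => m k + 2 :=
    pos_of_mul_pos_right (hγ.trans_le h) (by positivity)
  refine ⟨hα, ?_⟩
  have h1 := Real.log_le_log hγ h
  rw [Real.log_mul (by positivity) hα.ne', Real.log_pow] at h1
  have h2 := entropy_le_log_specRad_div κ ∅ hm (by simp)
  rw [le_div_iff₀ (vol_pos hm), ← gammaRad_eq] at h2
  have h3 : ((collar m).card : ℝ) = vol (fun k => m k + 2) - vol m := by
    rw [eq_sub_iff_add_eq]
    unfold vol
    exact_mod_cast card_collar_add m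
  rw [h3] at h1
  linarith

theorem vol_sub_two_div_tendsto (n : ℕ) :
    Tendsto (fun m : Fin n → ℕ => vol (fun k => m k - 2) / vol m) atTop (𝓝 1) := by
  have h : Tendsto (fun m : Fin n → ℕ => ∏ k, (1 - 2 / (m k : ℝ))) atTop
      (𝓝 (∏ _k : Fin n, (1 - 0 : ℝ))) := by
    refine tendsto_finsetProd _ fun k _ => tendsto_const_nhds.sub ?_
    exact tendsto_const_nhds.div_atTop
      (tendsto_natCast_atTop_atTop.comp (tendsto_eval_atTop k))
  simp only [sub_zero, Finset.prod_const_one] at h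
  refine h.congr' ?_
  -- Beyond 2 the truncated subtraction in m k - 2 is the genuine one.
  filter_upwards [eventually_forall_lt 2] with m hm
  unfold vol
  rw [← Finset.prod_div_distrib]
  refine Finset.prod_congr rfl fun k _ => ?_
  have h2 := hm k
  have h3 : (m k : ℝ) ≠ 0 := by
    have : m k ≠ 0 := by omega
    exact_mod_cast this
  rw [Nat.cast_sub h2.le]
  field_simp
  simp

theorem eventually_log_alphaRad_ge (n : ℕ) : ∀ᶠ m : Fin n → ℕ in atTop,
    0 < alphaRad κ m ∧
    entropy κ (n + 1) * (vol (fun k => m k - 2) / vol m) -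
      (1 - vol (fun k => m k - 2) / vol m) * Real.log 2 ≤ Real.log (alphaRad κ m) / vol m := by
  filter_upwards [eventually_forall_lt 2] with m hm
  obtain ⟨h1, h2⟩ := log_alphaRad_ge κ (m := fun k => m k - 2) fun k => by
    have := hm k; omega
  have h3 : (fun k => m k - 2 + 2) = m := funext fun k => by have := hm k; omega
  rw [h3] at h1 h2
  have hv : 0 < vol m := vol_pos fun k => by have := hm k; omega
  refine ⟨h1, ?_⟩
  rw [le_div_iff₀ hv]
  refine le_trans (le_of_eq ?_) h2
  field_simp

theorem tendsto_log_gammaRad (n : ℕ) :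
    Tendsto (fun m : Fin n → ℕ => Real.log (gammaRad κ m) / vol m) atTop
      (𝓝 (entropy κ (n + 1))) := by
  simpa only [gammaRad_eq] using tendsto_log_specRad_div κ n

theorem tendsto_alphaRad_lower_bound (n : ℕ) : Tendsto (fun m : Fin n → ℕ =>
    entropy κ (n + 1) * (vol (fun k => m k - 2) / vol m) -
      (1 - vol (fun k => m k - 2) / vol m) * Real.log 2) atTop (𝓝 (entropy κ (n + 1))) := by
  have h := vol_sub_two_div_tendsto n
  have h2 := (h.const_mul (entropy κ (n + 1))).sub
    (((tendsto_const_nhds (x := (1 : ℝ))).sub h).mul_const (Real.log 2))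
  simpa using h2

theorem tendsto_log_alphaRad (n : ℕ) :
    Tendsto (fun m : Fin n → ℕ => Real.log (alphaRad κ m) / vol m) atTop
      (𝓝 (entropy κ (n + 1))) := by
  refine tendsto_of_tendsto_of_tendsto_of_le_of_le' (tendsto_alphaRad_lower_bound κ n)
    (tendsto_log_gammaRad κ n) ((eventually_log_alphaRad_ge κ n).mono fun m h => h.2) ?_
  filter_upwards [eventually_forall_lt 0, eventually_log_alphaRad_ge κ n] with m h1 h2
  have hv := (vol_pos h1).le
  exact div_le_div_of_nonneg_right (Real.log_le_log h2.1
    ((alphaRad_le_betaRad κ m).trans (betaRad_le_gammaRad κ m))) hv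

theorem tendsto_log_betaRad (n : ℕ) :
    Tendsto (fun m : Fin n → ℕ => Real.log (betaRad κ m) / vol m) atTop
      (𝓝 (entropy κ (n + 1))) := by
  refine tendsto_of_tendsto_of_tendsto_of_le_of_le' (tendsto_log_alphaRad κ n)
    (tendsto_log_gammaRad κ n) ?_ ?_
  · filter_upwards [eventually_forall_lt 0, eventually_log_alphaRad_ge κ n] with m h1 h2
    exact div_le_div_of_nonneg_right (Real.log_le_log h2.1 (alphaRad_le_betaRad κ m))
      (vol_pos h1).le
  · filter_upwards [eventually_forall_lt 0, eventually_log_alphaRad_ge κ n] with m h1 h2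
    exact div_le_div_of_nonneg_right
      (Real.log_le_log (h2.1.trans_le (alphaRad_le_betaRad κ m)) (betaRad_le_gammaRad κ m))
      (vol_pos h1).le

theorem entropy_le_log_betaRad_div {m : Fin n → ℕ} (hm : ∀ k, 0 < m k ∧ Even (m k)) :
    entropy κ (n + 1) ≤ Real.log (betaRad κ m) / vol m := by
  rw [betaRad_eq, tilingMat_univ_eq]
  exact entropy_le_log_specRad_div κ Set.univ (fun k => (hm k).1) fun k _ => (hm k).2

end Limits

end MonomerDimer

open MonomerDimer in
/-- Bounds for the monomer-dimer entropy (`κ = .monomerDimer`) and the dimer entropy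
(`κ = .dimer`) in dimension `d`, where `m'` and `m⁻` have `n = d - 1` coordinates. The first two
parts say that the limits that define `h_d` and `h̄_{d-1}(m₁)` exist. -/
theorem theorem6p5 (κ : Kind) (d n : ℕ) (hd : 2 ≤ d) (hn : d = n + 1) :
    Tendsto (boxRate κ d) atTop (𝓝 (entropy κ d)) ∧
    (∀ m₁ : ℕ, 0 < m₁ → Tendsto (cylRate κ n m₁) atTop (𝓝 (cylEntropy κ n m₁))) ∧
    (∀ r : ℕ, 0 < r → entropy κ d ≤ cylEntropy κ n (2 * r) / (2 * r : ℝ)) ∧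
    (∀ p q : ℕ, 0 < p →
      (cylEntropy κ n (p + 2 * q) - cylEntropy κ n (2 * q)) / (p : ℝ) ≤ entropy κ d) ∧
    (∀ m' : Fin n → ℕ, (∀ k, 0 < m' k ∧ Even (m' k)) →
      entropy κ d ≤ Real.log (betaRad κ m') / vol m') ∧
    Tendsto (fun m' : Fin n → ℕ => Real.log (alphaRad κ m') / vol m') atTop
      (𝓝 (entropy κ d)) ∧
    Tendsto (fun m' : Fin n → ℕ => Real.log (betaRad κ m') / vol m') atTop
      (𝓝 (entropy κ d)) ∧
    Tendsto (fun m' : Fin n → ℕ => Real.log (gammaRad κ m') / vol m') atTop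
      (𝓝 (entropy κ d)) := by
  subst hn
  have hn : 0 < n := by omega
  exact ⟨(tendsto_boxRate κ n).1, fun _ hm => tendsto_cylRate κ hn hm,
    fun _ hr => entropy_le_cylEntropy_div κ hn hr, fun _ q hp => cylEntropy_sub_div_le κ hn hp q,
    fun _ hm => entropy_le_log_betaRad_div κ hm, tendsto_log_alphaRad κ n,
    tendsto_log_betaRad κ n, tendsto_log_gammaRad κ n⟩
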